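/- **Setting.** Let $A=\begin{bmatrix}0&I_3\\0&0\end{bmatrix}$, $B=\begin{bmatrix}0\\I_3\end{bmatrix}$. For $N$ rigid bodies with outer-loop (position and velocity) errors $e_i(t)\in\mathbb R^6$ and disturbances $w_i(t)\in\mathbb R^6$, consider the network $$\dot e_i=(A+B\bar L_{ii})e_i+\eta_i,\qquad \eta_i=\sum_{j=1}^N K_{ij}e_j+w_i,\qquad z_i=e_i,\qquad i=1,\dots,N,$$ with given local gains $\bar L_{ii}\in\mathbb R^{3\times 6}$ and with $M_{\eta e}=[K_{ij}]$, $K_{ij}=\begin{bmatrix}0&0\\ k^x_{ij}&k^v_{ij}\end{bmatrix}\in\mathbb R^{6\times6}$. Write $|\cdot|$ for the Euclidean norm, $\|\cdot\|$ for the spectral norm, $\|\cdot\|_1$ for the matrix 1-norm, $\mathcal S(X)=X+X^\top$, and $\|w_i\|_\infty=\sup_{t\ge0}|w_i(t)|$. Let $\nu_i,\rho_i,\epsilon_i\in\mathbb R$ and symmetric $R_i>0$ be given such that, for every $i$: * the subsystem $\dot e_i=(A+B\bar L_{ii})e_i+\eta_i$ with input $\eta_i$ and output $e_i$ is IF-OFP($\nu_i,\rho_i$),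 i.e. there is a $C^1$ storage function $V_i$ with $V_i(0)=0$, $V_i(x)>0$ for $x\ne0$, and $\nabla V_i(x)\cdot\big((A+B\bar L_{ii})x+\eta\big)\le-\nu_i|\eta|^2+\eta^\top x-\rho_i|x|^2$ for all $x,\eta\in\mathbb R^6$; * $\mathcal S\big((A+B\bar L_{ii})^\top R_i\big)\le-\rho_iI$; * $0<\delta_i<1$, where $\mu_i=\dfrac{\rho_i+\epsilon_i-1}{\lambda_{\max}(R_i)}$ and $\delta_i=\sqrt{\mu_i\lambda_{\min}(R_i)}$. **Centralized problem.** For given $\bar\gamma$, $c_0>0$ and weights $c_{ij}$, with $\tilde\gamma=\gamma^2$, $\gamma>0$, minimise $$\sum_{i,j}c_{ij}\|Q_{ij}\|_1+c_0\tilde\gamma$$ over $Q=[Q_{ij}]$ (each $Q_{ij}$ of the form $\begin{bmatrix}0&0\\ *&*\end{bmatrix}$), $\gamma$ and $p_i$, subject to $p_i>0$, $0<\tilde\gamma<\bar\gamma$, $$\begin{bmatrix}\mathbf X_p^{11}&0&Q&\mathbf X_p^{11}\\0&I&I&0\\Q^\top&I&-Q^\top\mathbf X^{12}-\mathbf X^{21}Q-\mathbf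 X_p^{22}&-\mathbf X^{21}\mathbf X_p^{11}\\\mathbf X_p^{11}&0&-\mathbf X_p^{11}\mathbf X^{12}&\tilde\gamma I\end{bmatrix}>0,$$ $$\mathcal S(R_iQ_{ii})\le p_i\nu_i\epsilon_iI,\qquad \sum_{j\ne i}\|R_iQ_{ij}\|<-p_i\nu_i\delta_i\qquad(i=1,\dots,N),$$ where $\mathbf X_p^{11}=\mathrm{diag}(-p_i\nu_iI)$, $\mathbf X_p^{22}=\mathrm{diag}(-p_i\rho_iI)$, $\mathbf X^{12}=\mathrm{diag}(-\tfrac1{2\nu_i}I)$, $\mathbf X^{21}=(\mathbf X^{12})^\top$. **Theorem.** Take any feasible point of this problem (in particular a minimiser, if there is one) and close the network with $M_{\eta e}=(\mathbf X_p^{11})^{-1}Q$. Then: 1. *(Finite-gain $L_2$-stability.)* The network is finite-gain $L_2$-stable from $w$ to $z$ with gain $\gamma$, and $\gamma^2<\bar\gamma$. That is, it has a $C^1$ storage function, zero at $0$ and positive elsewhere, whose derivative along the network is at most $\gamma^2|w|^2-|z|^2$; and along every solution $\|z\|_{L_2}\le\gamma\|w\|_{L_2}+b(e(0))$, on every interval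 $[0,T]$ and on $[0,\infty)$, where $b\geq 0$ depends only on the initial state and $b(0)=0$. 2. *(Scalable mesh stability.)* There are $\beta\in\mathcal{KL}$, $\sigma\in\mathcal K_\infty$ and $c_x,c_w>0$ such that, whenever $\sup_i|e_i(0)|<c_x$ and $w$ is measurable and bounded with $\sup_i\|w_i\|_\infty<c_w$, a solution exists on $[0,\infty)$ and every solution satisfies $$\sup_i|e_i(t)|\le\beta\Big(\sup_i|e_i(0)|,t\Big)+\sigma\Big(\sup_i\|w_i\|_\infty\Big)\qquad\text{for all }t\ge0 .$$ 3. *(Uniformity in the size of the network.)* Given any family of networks of arbitrary sizes $N$, each designed in this way, suppose that there are $\kappa>0$, $M$ and $\theta<1$ such that $\kappa\le\lambda_{\min}(R_i)$, $\lambda_{\max}(R_i)\le M$, $\kappa\le\mu_i$ and $\sum_{j\ne i}\|R_iQ_{ij}\|\le-\theta p_i\nu_i\delta_i$ for all agents of all networks of the family. Then the same $\beta,\sigma,c_x,c_w$ in 2 can be used for all the networks of the family, so they do not depend on $N$. -/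

import Mathlib

open MeasureTheory Set Filter Topology
open scoped ENNReal

noncomputable section

/-! ## Comparison functions -/

/-- Class `𝒦`: continuous and strictly increasing on `[0, ∞)`, zero at zero. -/
def IsClassK (α : ℝ → ℝ) : Prop :=
  ContinuousOn α (Ici 0) ∧ StrictMonoOn α (Ici 0) ∧ α 0 = 0

/-- Class `𝒦_∞`: class `𝒦` and unbounded. -/
def IsClassKInf (α : ℝ → ℝ) : Prop :=
  IsClassK α ∧ Tendsto α atTop atTop

/-- Class `𝒦ℒ`: class `𝒦` in the first argument, decreasing to zero in the second one. -/
def IsClassKL (β : ℝ → ℝ → ℝ) : Prop :=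
  (∀ t, 0 ≤ t → IsClassK fun r => β r t) ∧
  (∀ r, 0 ≤ r → AntitoneOn (β r) (Ici 0) ∧ Tendsto (β r) atTop (𝓝 0))

/-! ## Dissipativity about an equilibrium at the origin -/

/-- The system `ẋ = f(x, u)`, `y = h(x, u)`, with equilibrium `x = 0`, `u = 0`, `y = 0`, is
dissipative with supply rate `s`: there is a continuously differentiable storage function `V`,
positive away from the equilibrium and zero at it, with `∇V(x) f(x, u) ≤ s(u, y)`. -/
def IsDissipative {E U Y : Type*} [NormedAddCommGroup E] [NormedSpace ℝ E]
    [NormedAddCommGroup U] [NormedAddCommGroup Y]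
    (f : E → U → E) (h : E → U → Y) (s : U → Y → ℝ) : Prop :=
  f 0 0 = 0 ∧ h 0 0 = 0 ∧
  ∃ V : E → ℝ, ContDiff ℝ 1 V ∧ V 0 = 0 ∧ (∀ x, x ≠ 0 → 0 < V x) ∧
    ∀ x u, fderiv ℝ V x (f x u) ≤ s u (h x u)

/-- Supply rate of IF-OFP(`ν`, `ρ`) (input feedforward index `ν`, output feedback index `ρ`). -/
def supplyIFOFP {E : Type*} [NormedAddCommGroup E] [InnerProductSpace ℝ E] (ν ρ : ℝ)
    (u y : E) : ℝ :=
  -ν * ‖u‖ ^ 2 + inner ℝ u y - ρ * ‖y‖ ^ 2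

/-- Supply rate of finite-gain `L₂`-stability with gain `γ`. -/
def supplyL2G {U Y : Type*} [NormedAddCommGroup U] [NormedAddCommGroup Y] (γ : ℝ)
    (u : U) (y : Y) : ℝ :=
  γ ^ 2 * ‖u‖ ^ 2 - ‖y‖ ^ 2

/-! ## Matrices -/

/-- Coordinates of the outer-loop error of one rigid body: position error, velocity error. -/
abbrev BodyIdx := Fin 3 ⊕ Fin 3

/-- `ℝ⁶` with the Euclidean norm. -/
abbrev BodyState := EuclideanSpace ℝ BodyIdx

/-- The stacked vectors `[e_i]`, `[w_i]`, with the Euclidean norm `‖e‖² = ∑ i, ‖e_i‖²`. -/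
abbrev NetState (N : ℕ) := PiLp 2 fun _ : Fin N => BodyState

abbrev BodyMat := Matrix BodyIdx BodyIdx ℝ

/-- The linear map of `ℝ⁶` given by a matrix. -/
abbrev BodyMat.op (M : BodyMat) : BodyState →L[ℝ] BodyState :=
  Matrix.toEuclideanCLM (𝕜 := ℝ) M

/-- Spectral norm. -/
def specNorm (M : BodyMat) : ℝ := ‖BodyMat.op M‖

/-- Matrix 1-norm (largest absolute column sum). -/
def oneNorm (M : BodyMat) : ℝ := ⨆ b, ∑ a, |M a b|

/-- `𝒮(M) = M + Mᵀ`. -/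
def symSum (M : BodyMat) : BodyMat := M + M.transpose

/-- Smallest eigenvalue (used for symmetric matrices). -/
def lambdaMin (M : BodyMat) : ℝ := sInf (spectrum ℝ M)

/-- Largest eigenvalue (used for symmetric matrices). -/
def lambdaMax (M : BodyMat) : ℝ := sSup (spectrum ℝ M)

/-- `A = [0 I; 0 0]`. -/
def outerA : BodyMat := Matrix.fromBlocks 0 1 0 0

/-- `B = [0; I]`. -/
def outerB : Matrix BodyIdx (Fin 3) ℝ := Matrix.fromRows 0 1

/-! ## The error network -/

/-- The gains of a network of `N` rigid bodies: the local controllers `L̄_ii` and the blocks `K_ij`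
of the interconnection matrix `M_{ηe}`. -/
structure ErrorNetwork (N : ℕ) where
  Lbar : Fin N → Matrix (Fin 3) BodyIdx ℝ
  K : Fin N → Fin N → BodyMat

/-- Right-hand side `ė_i = (A + B L̄_ii) e_i + η_i` of one subsystem with input `η_i`. -/
def subsystemField (L : Matrix (Fin 3) BodyIdx ℝ) (x η : BodyState) : BodyState :=
  BodyMat.op (outerA + outerB * L) x + η

namespace ErrorNetwork

variable {N : ℕ}

/-- The subsystem inputs `η_i = ∑ j, K_ij e_j + w_i` (so `M_{ηw} = I`). -/
def input (net : ErrorNetwork N) (e w : NetState N) (i : Fin N) : BodyState :=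
  ∑ j, BodyMat.op (net.K i j) (e j) + w i

/-- Right-hand side of the closed-loop network. -/
def field (net : ErrorNetwork N) (e w : NetState N) : NetState N :=
  WithLp.toLp 2 fun i => subsystemField (net.Lbar i) (e i) (net.input e w i)

/-- The performance output `z = M_{ze} e + M_{zw} w` with `M_{ze} = I`, `M_{zw} = 0`. -/
def output (_net : ErrorNetwork N) (e _w : NetState N) : NetState N := e

/-- `e` is a (Carathéodory) solution of the closed-loop network on `[0, ∞)` for the
disturbance `w`. -/
def IsSolution (net : ErrorNetwork N) (w e : ℝ → NetState N) : Prop :=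
  ContinuousOn e (Ici 0) ∧
  ∀ t, 0 ≤ t → IntervalIntegrable (fun s => net.field (e s) (w s)) volume 0 t ∧
    e t = e 0 + ∫ s in (0 : ℝ)..t, net.field (e s) (w s)

/-- Finite-gain `L₂`-stability from `w` to `z` with gain `γ`: the network is dissipative for the
supply rate `γ²‖w‖² - ‖z‖²`, and along every solution the `L₂` norms of `z` and `w`, on every
`[0, T]` and on `[0, ∞)`, satisfy `‖z‖ ≤ γ ‖w‖ + b(e(0))`, where the bias `b` vanishes at rest. -/
def IsL2Stable (net : ErrorNetwork N) (γ : ℝ) : Prop :=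
  IsDissipative net.field net.output (supplyL2G γ) ∧
  ∃ b : NetState N → NNReal, b 0 = 0 ∧
    ∀ w e : ℝ → NetState N, net.IsSolution w e →
      ∀ I : Set ℝ, ((∃ T : ℝ, 0 ≤ T ∧ I = Icc 0 T) ∨ I = Ici 0) →
        eLpNorm (fun t => net.output (e t) (w t)) 2 (volume.restrict I) ≤
          ENNReal.ofReal γ * eLpNorm w 2 (volume.restrict I) + (b (e 0) : ℝ≥0∞)

end ErrorNetwork

/-- Scalable mesh stability, about the equilibrium `e = 0`, of a family of networks of arbitrary
sizes `N l`: one `β ∈ 𝒦ℒ`, one `σ ∈ 𝒦_∞` and one pair `c_x, c_w > 0` serve all members. For small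
initial errors and small bounded disturbances a solution exists on `[0, ∞)`, and every solution
satisfies the estimate. -/
def IsScalableMeshStable {Λ : Type*} (N : Λ → ℕ) (net : ∀ l, ErrorNetwork (N l)) : Prop :=
  ∃ (β : ℝ → ℝ → ℝ) (σ : ℝ → ℝ) (cx cw : ℝ),
    IsClassKL β ∧ IsClassKInf σ ∧ 0 < cx ∧ 0 < cw ∧
    ∀ (l : Λ) (e₀ : NetState (N l)) (w : ℝ → NetState (N l)),
      AEStronglyMeasurable w (volume.restrict (Ici 0)) →
      (∀ i, BddAbove (range fun t : Ici (0 : ℝ) => ‖w t i‖)) →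
      (⨆ i, ‖e₀ i‖) < cx →
      (⨆ i, ⨆ t : Ici (0 : ℝ), ‖w t i‖) < cw →
      (∃ e, (net l).IsSolution w e ∧ e 0 = e₀) ∧
      ∀ e, (net l).IsSolution w e → e 0 = e₀ → ∀ t, 0 ≤ t →
        (⨆ i, ‖e t i‖) ≤ β (⨆ i, ‖e₀ i‖) t + σ (⨆ i, ⨆ t : Ici (0 : ℝ), ‖w t i‖)

/-! ## The centralized co-design problem -/

/-- The given data: local controllers `L̄_ii`, passivity indices `ν_i`, `ρ_i`, matrices `R_i`,
scalars `ε_i`, cost weights `c_ij`, `c_0`, and the bound `γ̄` on the squared gain. -/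
structure DesignData (N : ℕ) where
  Lbar : Fin N → Matrix (Fin 3) BodyIdx ℝ
  ν : Fin N → ℝ
  ρ : Fin N → ℝ
  R : Fin N → BodyMat
  ε : Fin N → ℝ
  c : Fin N → Fin N → ℝ
  c₀ : ℝ
  γbar : ℝ

/-- The decision variables `Q = [Q_ij]`, `γ` and `p_i`. -/
structure DesignVars (N : ℕ) where
  Q : Fin N → Fin N → BodyMat
  γ : ℝ
  p : Fin N → ℝ

/-- A minimisation problem. -/
structure MinProblem (α : Type*) where
  cost : α → ℝ
  feasible : Set α

/-- The block matrix `[Q_ij]`. -/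
def stackBlocks {N : ℕ} (Q : Fin N → Fin N → BodyMat) :
    Matrix (Fin N × BodyIdx) (Fin N × BodyIdx) ℝ :=
  Matrix.of fun ia jb => Q ia.1 jb.1 ia.2 jb.2

/-- The block-diagonal matrix `diag([d_i I])`. -/
def scalarBlocks {N : ℕ} (d : Fin N → ℝ) : Matrix (Fin N × BodyIdx) (Fin N × BodyIdx) ℝ :=
  Matrix.diagonal fun ia => d ia.1

namespace DesignData

variable {N : ℕ}

/-- `μ_i = (ρ_i + ε_i - 1) / λ_max(R_i)`. -/
def μ (S : DesignData N) (i : Fin N) : ℝ := (S.ρ i + S.ε i - 1) / lambdaMax (S.R i)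

/-- `δ_i = √(μ_i λ_min(R_i))`. -/
def δ (S : DesignData N) (i : Fin N) : ℝ := Real.sqrt (S.μ i * lambdaMin (S.R i))

/-- What is known about the local loops: every subsystem `ė_i = (A + B L̄_ii) e_i + η_i`, with
output `e_i`, is IF-OFP(`ν_i`, `ρ_i`); `R_i > 0` with `𝒮((A + B L̄_ii)ᵀ R_i) ≤ -ρ_i I`; and
`0 < δ_i < 1`. -/
structure LocalLoops (S : DesignData N) : Prop where
  ifofp : ∀ i, IsDissipative (subsystemField (S.Lbar i)) (fun x _ => x)
    (supplyIFOFP (S.ν i) (S.ρ i))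
  R_posDef : ∀ i, (S.R i).PosDef
  lyapunov : ∀ i, (-(S.ρ i) • (1 : BodyMat) -
    symSum ((outerA + outerB * S.Lbar i).transpose * S.R i)).PosSemidef
  δ_pos : ∀ i, 0 < S.δ i
  δ_lt_one : ∀ i, S.δ i < 1

/-- `𝐗_p¹¹ = diag([-p_i ν_i I])`. -/
def Xp11 (S : DesignData N) (D : DesignVars N) :
    Matrix (Fin N × BodyIdx) (Fin N × BodyIdx) ℝ :=
  scalarBlocks fun i => -(D.p i * S.ν i)

/-- `𝐗_p²² = diag([-p_i ρ_i I])`. -/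
def Xp22 (S : DesignData N) (D : DesignVars N) :
    Matrix (Fin N × BodyIdx) (Fin N × BodyIdx) ℝ :=
  scalarBlocks fun i => -(D.p i * S.ρ i)

/-- `𝐗¹² = diag([-(1 / (2 ν_i)) I])`. -/
def X12 (S : DesignData N) :
    Matrix (Fin N × BodyIdx) (Fin N × BodyIdx) ℝ :=
  scalarBlocks fun i => -(1 / (2 * S.ν i))

/-- `𝐗²¹ = (𝐗¹²)ᵀ`. -/
def X21 (S : DesignData N) :
    Matrix (Fin N × BodyIdx) (Fin N × BodyIdx) ℝ :=
  S.X12.transpose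

/-- The `4 × 4`-block matrix of the linear matrix inequality. -/
def lmiMatrix (S : DesignData N) (D : DesignVars N) :
    Matrix (((Fin N × BodyIdx) ⊕ (Fin N × BodyIdx)) ⊕ ((Fin N × BodyIdx) ⊕ (Fin N × BodyIdx)))
      (((Fin N × BodyIdx) ⊕ (Fin N × BodyIdx)) ⊕ ((Fin N × BodyIdx) ⊕ (Fin N × BodyIdx))) ℝ :=
  let Q := stackBlocks D.Q
  Matrix.fromBlocks
    (Matrix.fromBlocks (S.Xp11 D) 0
      0 1)
    (Matrix.fromBlocks Q (S.Xp11 D)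
      1 0)
    (Matrix.fromBlocks Q.transpose 1
      (S.Xp11 D) 0)
    (Matrix.fromBlocks (-(Q.transpose * S.X12) - S.X21 * Q - S.Xp22 D) (-(S.X21 * S.Xp11 D))
      (-(S.Xp11 D * S.X12)) (D.γ ^ 2 • 1))

/-- `∑_{j ≠ i} ‖R_i Q_ij‖`. -/
def couplingSum (S : DesignData N) (D : DesignVars N) (i : Fin N) : ℝ :=
  ∑ j ∈ Finset.univ.erase i, specNorm (S.R i * D.Q i j)

/-- The constraints of the centralized problem. -/
structure Constraints (S : DesignData N) (D : DesignVars N) : Prop where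
  p_pos : ∀ i, 0 < D.p i
  γ_pos : 0 < D.γ
  γ_lt : D.γ ^ 2 < S.γbar
  /-- `Q_ij = [0 0; * *]`, the structure of the blocks `K_ij`. -/
  structured : ∀ i j (a : Fin 3) (b : BodyIdx), D.Q i j (Sum.inl a) b = 0
  lmi : (S.lmiMatrix D).PosDef
  diag_block : ∀ i, ((D.p i * S.ν i * S.ε i) • (1 : BodyMat) -
    symSum (S.R i * D.Q i i)).PosSemidef
  weak_coupling : ∀ i, S.couplingSum D i < -(D.p i * S.ν i * S.δ i)

/-- Minimise `∑ c_ij ‖Q_ij‖₁ + c_0 γ²` subject to the constraints. -/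
def centralizedProblem (S : DesignData N) : MinProblem (DesignVars N) where
  cost D := ∑ i, ∑ j, S.c i j * oneNorm (D.Q i j) + S.c₀ * D.γ ^ 2
  feasible := {D | S.Constraints D}

/-- The network closed with `M_{ηe} = (𝐗_p¹¹)⁻¹ Q`. -/
def closedLoop (S : DesignData N) (D : DesignVars N) : ErrorNetwork N where
  Lbar := S.Lbar
  K i j := Matrix.of fun a b => ((S.Xp11 D)⁻¹ * stackBlocks D.Q) (i, a) (j, b)

end DesignData

/-- The data of a family of designs are bounded uniformly over all agents of all its members, and
so is the margin in the weak-coupling bound. -/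
def UniformData {Λ : Type*} {N : Λ → ℕ} (S : ∀ l, DesignData (N l))
    (D : ∀ l, DesignVars (N l)) : Prop :=
  ∃ κ M θ : ℝ, 0 < κ ∧ θ < 1 ∧ ∀ l i,
    κ ≤ lambdaMin ((S l).R i) ∧ lambdaMax ((S l).R i) ≤ M ∧ κ ≤ (S l).μ i ∧
    (S l).couplingSum (D l) i ≤ θ * -((D l).p i * (S l).ν i * (S l).δ i)

end

/-!
Evaluated at `(-η, -e, e, w)`, where `𝐗_p¹¹ η = Q e + 𝐗_p¹¹ w`, the quadratic form of the matrix in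
the linear matrix inequality equals `γ²|w|² - |e|²` minus the `p`-weighted sum of the IF-OFP
supply rates. Hence `∑ p_i V_i` is a storage function for the `L₂` gain `γ`, and integrating the
dissipation inequality bounds the `L₂` norms with bias `√(V(e(0)))`.

For mesh stability, let `Y_i = ⟪e_i, R_i e_i⟫ / λ_min(R_i) ≥ |e_i|²`. The Lyapunov inequality and
the bound on `𝒮(R_i Q_ii)` make the energy `⟪e_i, R_i e_i⟫` decay at rate `μ_i` with a surplus
`|e_i|²`, which pays for the coupling: if all `Y_j ≤ B`, weak coupling gives
`Ẏ_i ≤ μ_i (-Y_i + θ B + c)`, with `θ < 1` and `c` proportional to `sup_t |w(t)|²`. A first-crossing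
argument then keeps every `Y_i` below `a e^{-αt} + 2c / (1 - θ)`, where `α = κ(1 - θ)/2`. Only `κ`,
`M` and `θ` enter, and not the number of agents.
-/

/-! ## Primitives on the half-line -/

/-- `e` is a primitive on `[0, ∞)` of the locally integrable function `g`: the notion of a
Carathéodory solution, without reference to an equation. -/
def IsPrimitiveOnIci {E : Type*} [NormedAddCommGroup E] [NormedSpace ℝ E] (e g : ℝ → E) : Prop :=
  ∀ t, 0 ≤ t → IntervalIntegrable g volume 0 t ∧ e t = e 0 + ∫ s in (0 : ℝ)..t, g s

namespace IsPrimitiveOnIci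

variable {E : Type*} [NormedAddCommGroup E] [NormedSpace ℝ E] {e e' g g' : ℝ → E} {a b : ℝ}

theorem intervalIntegrable (h : IsPrimitiveOnIci e g) (ha : 0 ≤ a) (hb : 0 ≤ b) :
    IntervalIntegrable g volume a b :=
  (h a ha).1.symm.trans (h b hb).1

theorem integral_eq_sub (h : IsPrimitiveOnIci e g) (ha : 0 ≤ a) (hb : 0 ≤ b) :
    ∫ s in a..b, g s = e b - e a := by
  rw [(h a ha).2, (h b hb).2, add_sub_add_left_eq_sub,
    intervalIntegral.integral_interval_sub_left (h b hb).1 (h a ha).1]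

theorem continuousOn (h : IsPrimitiveOnIci e g) : ContinuousOn e (Ici 0) := by
  intro t ht
  have ht' : (0 : ℝ) ≤ t + 1 := add_nonneg ht zero_le_one
  have hprim : ContinuousOn (fun s => e 0 + ∫ r in (0 : ℝ)..s, g r) (Icc 0 (t + 1)) := by
    have hg := (intervalIntegrable_iff' (by simp)).1 (h _ ht').1
    rw [← uIcc_of_le ht']
    exact continuousOn_const.add (intervalIntegral.continuousOn_primitive_interval hg)
  refine ((hprim.congr fun s hs => (h s hs.1).2) t ⟨ht, by linarith⟩).mono_of_mem_nhdsWithin ?_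
  exact mem_of_superset (inter_mem_nhdsWithin _ (Iic_mem_nhds (lt_add_one t))) fun s hs => hs

theorem congr (h : IsPrimitiveOnIci e g) (hg : ∀ t, 0 ≤ t → g t = g' t) :
    IsPrimitiveOnIci e g' := by
  intro t ht
  have heq : EqOn g g' (uIcc 0 t) := fun s hs => hg s (by rw [uIcc_of_le ht] at hs; exact hs.1)
  exact ⟨(h t ht).1.congr (heq.mono uIoc_subset_uIcc),
    (h t ht).2.trans (by rw [intervalIntegral.integral_congr heq])⟩

theorem add (h : IsPrimitiveOnIci e g) (h' : IsPrimitiveOnIci e' g') :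
    IsPrimitiveOnIci (fun t => e t + e' t) fun t => g t + g' t := by
  intro t ht
  refine ⟨(h t ht).1.add (h' t ht).1, ?_⟩
  rw [intervalIntegral.integral_add (h t ht).1 (h' t ht).1]
  calc e t + e' t = (e 0 + ∫ s in (0 : ℝ)..t, g s) + (e' 0 + ∫ s in (0 : ℝ)..t, g' s) := by
        rw [← (h t ht).2, ← (h' t ht).2]
    _ = _ := add_add_add_comm _ _ _ _

theorem const_smul (h : IsPrimitiveOnIci e g) (c : ℝ) :
    IsPrimitiveOnIci (fun t => c • e t) fun t => c • g t := by
  intro t ht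
  refine ⟨(h t ht).1.smul c, ?_⟩
  rw [intervalIntegral.integral_smul, ← smul_add, ← (h t ht).2]

theorem of_hasDerivAt [CompleteSpace E] (h : ∀ t, HasDerivAt e (g t) t) (hg : Continuous g) :
    IsPrimitiveOnIci e g := by
  intro t _
  have hint : IntervalIntegrable g volume 0 t := hg.intervalIntegrable 0 t
  refine ⟨hint, ?_⟩
  rw [intervalIntegral.integral_eq_sub_of_hasDerivAt (fun s _ => h s) hint, add_sub_cancel]

theorem ae_hasDerivAt [CompleteSpace E] (h : IsPrimitiveOnIci e g) (hb : 0 ≤ b) :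
    ∀ᵐ t, t ∈ Ioc 0 b → HasDerivAt e (g t) t := by
  filter_upwards [(h b hb).1.ae_hasDerivAt_integral] with t ht htb
  have hd := ht (by rw [uIcc_of_le hb]; exact Ioc_subset_Icc_self htb) 0 left_mem_uIcc
  refine (hd.const_add (e 0)).congr_of_eventuallyEq ?_
  filter_upwards [Ioi_mem_nhds htb.1] with s hs using (h s (le_of_lt hs)).2

end IsPrimitiveOnIci

theorem absolutelyContinuousOnInterval_of_dist_le {X Y : Type*} [PseudoMetricSpace X]
    [PseudoMetricSpace Y] {f : ℝ → X} {G : ℝ → Y} {a b K : ℝ}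
    (hG : AbsolutelyContinuousOnInterval G a b)
    (h : ∀ x ∈ uIcc a b, ∀ y ∈ uIcc a b, dist (f x) (f y) ≤ K * dist (G x) (G y)) :
    AbsolutelyContinuousOnInterval f a b := by
  refine squeeze_zero' (g := fun E : ℕ × (ℕ → ℝ × ℝ) =>
    K * ∑ i ∈ Finset.range E.1, dist (G (E.2 i).1) (G (E.2 i).2))
    (Eventually.of_forall fun E => Finset.sum_nonneg fun _ _ => dist_nonneg) ?_
    (by simpa only [mul_zero] using Tendsto.const_mul K hG)
  have hdisjoint : ∀ᶠ E : ℕ × (ℕ → ℝ × ℝ) in AbsolutelyContinuousOnInterval.totalLengthFilter ⊓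
      𝓟 (AbsolutelyContinuousOnInterval.disjWithin a b),
      E ∈ AbsolutelyContinuousOnInterval.disjWithin a b :=
    mem_inf_of_right (mem_principal_self _)
  filter_upwards [hdisjoint] with E hE
  rw [Finset.mul_sum]
  exact Finset.sum_le_sum fun i hi => h _ (hE.1 i hi).1 _ (hE.1 i hi).2

namespace IsPrimitiveOnIci

variable {E F : Type*} [NormedAddCommGroup E] [NormedSpace ℝ E] [NormedAddCommGroup F]
  {e g : ℝ → E} {b : ℝ}

theorem absolutelyContinuousOnInterval_comp (h : IsPrimitiveOnIci e g) {V : E → F}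
    (hV : LocallyLipschitz V) (hb : 0 ≤ b) :
    AbsolutelyContinuousOnInterval (fun t => V (e t)) 0 b := by
  have hcompact : IsCompact (e '' Icc 0 b) :=
    isCompact_Icc.image_of_continuousOn (h.continuousOn.mono Icc_subset_Ici_self)
  obtain ⟨K, hK⟩ :=
    LocallyLipschitzOn.exists_lipschitzOnWith_of_compact hcompact hV.locallyLipschitzOn
  refine absolutelyContinuousOnInterval_of_dist_le (K := K)
    ((h b hb).1.norm.absolutelyContinuousOnInterval_intervalIntegral left_mem_uIcc) ?_
  rw [uIcc_of_le hb]
  intro x hx y hy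
  refine (hK.dist_le_mul _ (mem_image_of_mem e hx) _ (mem_image_of_mem e hy)).trans
    (mul_le_mul_of_nonneg_left ?_ K.2)
  rw [dist_eq_norm, dist_eq_norm, ← h.integral_eq_sub hy.1 hx.1,
    intervalIntegral.integral_interval_sub_left (h x hx.1).1.norm (h y hy.1).1.norm]
  exact intervalIntegral.norm_integral_le_abs_integral_norm

theorem contDiff_comp [CompleteSpace E] (h : IsPrimitiveOnIci e g) {V : E → ℝ}
    (hV : ContDiff ℝ 1 V) :
    IsPrimitiveOnIci (fun t => V (e t)) fun t => fderiv ℝ V (e t) (g t) := by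
  intro t ht
  have hac := h.absolutelyContinuousOnInterval_comp hV.locallyLipschitz ht
  have hderiv : ∀ᵐ s, s ∈ uIoc 0 t → deriv (fun r => V (e r)) s = fderiv ℝ V (e s) (g s) := by
    rw [uIoc_of_le ht]
    filter_upwards [h.ae_hasDerivAt ht] with s hs hst
    exact ((hV.differentiable one_ne_zero (e s)).hasFDerivAt.comp_hasDerivAt s (hs hst)).deriv
  refine ⟨hac.intervalIntegrable_deriv.congr_ae
    ((ae_restrict_iff' measurableSet_uIoc).2 hderiv), ?_⟩
  rw [← intervalIntegral.integral_congr_ae hderiv, hac.integral_deriv_eq_sub, add_sub_cancel]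

end IsPrimitiveOnIci

theorem exists_first_nonneg_of_neg {ι : Type*} [Finite ι] {f : ι → ℝ → ℝ}
    (hf : ∀ i, ContinuousOn (f i) (Ici 0)) (h0 : ∀ i, f i 0 < 0) {i : ι} {t : ℝ} (ht : 0 ≤ t)
    (hit : 0 ≤ f i t) :
    ∃ k τ, 0 < τ ∧ 0 ≤ f k τ ∧ ∀ j, ∀ s ∈ Ico 0 τ, f j s < 0 := by
  let C : Set ℝ := ⋃ j, {s ∈ Icc 0 t | 0 ≤ f j s}
  have hC : IsCompact C := isCompact_iUnion fun j =>
    isCompact_Icc.of_isClosed_subset (ContinuousOn.preimage_isClosed_of_isClosed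
      ((hf j).mono Icc_subset_Ici_self) isClosed_Icc isClosed_Ici) fun s hs => hs.1
  obtain ⟨τ, hτ⟩ := hC.exists_isLeast ⟨t, mem_iUnion.2 ⟨i, ⟨ht, le_rfl⟩, hit⟩⟩
  obtain ⟨k, ⟨hτ0, hτt⟩, hkτ⟩ := mem_iUnion.1 hτ.1
  refine ⟨k, τ, hτ0.lt_of_ne fun hz => (h0 k).not_ge (hz ▸ hkτ), hkτ, fun j s hs => ?_⟩
  by_contra! hj
  exact (hτ.2 (mem_iUnion.2 ⟨j, ⟨hs.1, hs.2.le.trans hτt⟩, hj⟩)).not_gt hs.2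

theorem neg_of_rate_nonpos_near_zero {ι : Type*} [Finite ι] {f g lo : ι → ℝ → ℝ}
    (hf : ∀ i, IsPrimitiveOnIci (f i) (g i)) (hlo : ∀ i, ContinuousOn (lo i) (Ici 0))
    (hlo_neg : ∀ i t, 0 ≤ t → lo i t < 0) (h0 : ∀ i, f i 0 < 0)
    (hg : ∀ i t, 0 ≤ t → (∀ j, f j t ≤ 0) → lo i t < f i t → g i t ≤ 0)
    (i : ι) {t : ℝ} (ht : 0 ≤ t) : f i t < 0 := by
  by_contra! hit
  obtain ⟨k, τ, hτ, hkτ, hbefore⟩ :=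
    exists_first_nonneg_of_neg (fun j => (hf j).continuousOn) h0 ht hit
  have hnear : ∀ᶠ s in 𝓝[≤] τ, lo k s < f k s :=
    (((hlo k).continuousAt (Ici_mem_nhds hτ)).eventually_lt
      ((hf k).continuousOn.continuousAt (Ici_mem_nhds hτ))
      ((hlo_neg k τ hτ.le).trans_le hkτ)).filter_mono nhdsWithin_le_nhds
  obtain ⟨l, hl, hlτ⟩ := mem_nhdsLE_iff_exists_Icc_subset.1 hnear
  have ha : 0 ≤ max l 0 := le_max_right l 0
  have haτ : max l 0 < τ := max_lt hl hτ
  have hdecr : ∫ s in max l 0..τ, g k s ≤ 0 := by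
    refine (intervalIntegral.integral_mono_on_of_le_Ioo haτ.le
      ((hf k).intervalIntegrable ha hτ.le) intervalIntegrable_const fun s hs => ?_).trans_eq
      intervalIntegral.integral_zero
    exact hg k s (ha.trans hs.1.le) (fun j => (hbefore j s ⟨ha.trans hs.1.le, hs.2⟩).le)
      (hlτ ⟨(le_max_left l 0).trans hs.1.le, hs.2.le⟩)
  rw [(hf k).integral_eq_sub ha hτ.le, sub_nonpos] at hdecr
  exact (hbefore k _ ⟨ha, haτ⟩).not_ge (hkτ.trans hdecr)

/-! ## Linear equations -/

section Linear

variable {E : Type*} [NormedAddCommGroup E] [NormedSpace ℝ E] [CompleteSpace E]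

theorem exists_hasDerivAt_linear_add (F : E →L[ℝ] E) {u : ℝ → E} (hu : Continuous u) (x₀ : E) :
    ∃ y : ℝ → E, y 0 = x₀ ∧ ∀ t, HasDerivAt y (F (y t) + u t) t := by
  let _ := NormedAlgebra.restrictScalars ℚ ℝ (E →L[ℝ] E)
  let Φ : ℝ → E →L[ℝ] E := fun t => NormedSpace.exp (t • F)
  have hΦ : ∀ t, HasDerivAt Φ (F * Φ t) t := fun t => hasDerivAt_exp_smul_const' F t
  have hΦ_cont : Continuous Φ := continuous_iff_continuousAt.2 fun t => (hΦ t).continuousAt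
  have hΦ_zero : Φ 0 = 1 := by simp only [Φ, zero_smul, NormedSpace.exp_zero]
  have hΦ_inv : ∀ t x, Φ t (Φ (-t) x) = x := by
    intro t x
    have hmul : Φ t * Φ (-t) = 1 := by
      simp only [Φ, neg_smul]
      rw [← NormedSpace.exp_add_of_commute (Commute.refl (t • F)).neg_right, add_neg_cancel,
        NormedSpace.exp_zero]
    exact DFunLike.congr_fun hmul x
  have hk : Continuous fun s => Φ (-s) (u s) := (hΦ_cont.comp continuous_neg).clm_apply hu
  refine ⟨fun t => Φ t (x₀ + ∫ s in (0 : ℝ)..t, Φ (-s) (u s)), by simp [hΦ_zero], fun t => ?_⟩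
  have hint : HasDerivAt (fun t => x₀ + ∫ s in (0 : ℝ)..t, Φ (-s) (u s)) (Φ (-t) (u t)) t :=
    (hk.integral_hasStrictDerivAt 0 t).hasDerivAt.const_add x₀
  simpa only [hΦ_inv, mul_apply_eq_comp] using (hΦ t).clm_apply hint

-- The primitive of the forcing is subtracted off, which leaves an equation with continuous forcing.
theorem exists_isPrimitiveOnIci_linear_add (F : E →L[ℝ] E) {w : ℝ → E}
    (hw : ∀ t, 0 ≤ t → IntervalIntegrable w volume 0 t) (x₀ : E) :
    ∃ e : ℝ → E, IsPrimitiveOnIci e (fun t => F (e t) + w t) ∧ e 0 = x₀ := by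
  let W : ℝ → E := fun t => ∫ s in (0 : ℝ)..t, w s
  have hW0 : W 0 = 0 := intervalIntegral.integral_same
  have hW : IsPrimitiveOnIci W w := fun t ht => ⟨hw t ht, by rw [hW0, zero_add]⟩
  have hu : Continuous fun t => F (W (max t 0)) :=
    F.continuous.comp (hW.continuousOn.comp_continuous (by fun_prop) fun t => le_max_right t 0)
  obtain ⟨y, hy0, hy⟩ := exists_hasDerivAt_linear_add F hu x₀
  have hy_cont : Continuous y := continuous_iff_continuousAt.2 fun t => (hy t).continuousAt
  refine ⟨fun t => y t + W t, ?_, by simp only [hy0, hW0, add_zero]⟩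
  refine ((IsPrimitiveOnIci.of_hasDerivAt hy ((F.continuous.comp hy_cont).add hu)).add hW).congr
    fun t ht => ?_
  rw [max_eq_left ht, map_add]

end Linear

/-! ## Gains from integrated dissipation inequalities -/

section Gain

variable {X Y : Type*} [NormedAddCommGroup X] [NormedAddCommGroup Y]

theorem enorm_sq_add_ofReal_le {v : X} {y : Y} {r : ℝ} (h : r ≤ ‖v‖ ^ 2 - ‖y‖ ^ 2) :
    ‖y‖ₑ ^ 2 + ENNReal.ofReal r ≤ ‖v‖ₑ ^ 2 + ENNReal.ofReal (-r) := by
  rw [← ofReal_norm, ← ofReal_norm, ← ENNReal.ofReal_pow (norm_nonneg _),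
    ← ENNReal.ofReal_pow (norm_nonneg _)]
  rcases le_total 0 r with hr | hr
  · rw [ENNReal.ofReal_of_nonpos (neg_nonpos.2 hr), add_zero,
      ← ENNReal.ofReal_add (sq_nonneg _) hr]
    exact ENNReal.ofReal_le_ofReal (by linarith)
  · rw [ENNReal.ofReal_of_nonpos hr, add_zero,
      ← ENNReal.ofReal_add (sq_nonneg _) (neg_nonneg.2 hr)]
    exact ENNReal.ofReal_le_ofReal (by linarith)

theorem IsPrimitiveOnIci.lintegral_ofReal_neg_le {f g : ℝ → ℝ} (h : IsPrimitiveOnIci f g)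
    (hf : ∀ t, 0 ≤ f t) {T : ℝ} (hT : 0 ≤ T) :
    ∫⁻ t in Icc 0 T, ENNReal.ofReal (-g t) ≤
      (∫⁻ t in Icc 0 T, ENNReal.ofReal (g t)) + ENNReal.ofReal (f 0) := by
  have hint : IntegrableOn g (Icc 0 T) :=
    (intervalIntegrable_iff_integrableOn_Icc_of_le hT (by simp)).1 (h T hT).1
  have hsub := integral_eq_lintegral_pos_part_sub_lintegral_neg_part hint
  rw [integral_Icc_eq_integral_Ioc, ← intervalIntegral.integral_of_le hT,
    h.integral_eq_sub le_rfl hT] at hsub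
  have hneg : ∫⁻ t in Icc 0 T, ENNReal.ofReal (-g t) ≠ ⊤ := hint.neg.lintegral_lt_top.ne
  rw [← ENNReal.ofReal_toReal hneg, ← ENNReal.ofReal_toReal hint.lintegral_lt_top.ne,
    ← ENNReal.ofReal_add ENNReal.toReal_nonneg (hf 0)]
  exact ENNReal.ofReal_le_ofReal (by linarith [hf T])

-- `v` and `y` may fail to be measurable, so only the positive and negative parts of `g`, which is
-- integrable, are split off from the integrals.
theorem IsPrimitiveOnIci.lintegral_enorm_sq_le {f g : ℝ → ℝ} (h : IsPrimitiveOnIci f g)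
    (hf : ∀ t, 0 ≤ f t) {v : ℝ → X} {y : ℝ → Y} (hg : ∀ t, g t ≤ ‖v t‖ ^ 2 - ‖y t‖ ^ 2) {T : ℝ}
    (hT : 0 ≤ T) :
    ∫⁻ t in Icc 0 T, ‖y t‖ₑ ^ 2 ≤ (∫⁻ t in Icc 0 T, ‖v t‖ₑ ^ 2) + ENNReal.ofReal (f 0) := by
  have hint : IntegrableOn g (Icc 0 T) :=
    (intervalIntegrable_iff_integrableOn_Icc_of_le hT (by simp)).1 (h T hT).1
  have hneg_meas : AEMeasurable (fun t => ENNReal.ofReal (-g t)) (volume.restrict (Icc 0 T)) :=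
    hint.aemeasurable.neg.ennreal_ofReal
  refine (ENNReal.add_le_add_iff_right hint.lintegral_lt_top.ne).1 ?_
  calc (∫⁻ t in Icc 0 T, ‖y t‖ₑ ^ 2) + ∫⁻ t in Icc 0 T, ENNReal.ofReal (g t)
      = ∫⁻ t in Icc 0 T, (‖y t‖ₑ ^ 2 + ENNReal.ofReal (g t)) :=
        (lintegral_add_right' _ hint.aemeasurable.ennreal_ofReal).symm
    _ ≤ ∫⁻ t in Icc 0 T, (‖v t‖ₑ ^ 2 + ENNReal.ofReal (-g t)) :=
        lintegral_mono fun t => enorm_sq_add_ofReal_le (hg t)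
    _ = (∫⁻ t in Icc 0 T, ‖v t‖ₑ ^ 2) + ∫⁻ t in Icc 0 T, ENNReal.ofReal (-g t) :=
        lintegral_add_right' _ hneg_meas
    _ ≤ (∫⁻ t in Icc 0 T, ‖v t‖ₑ ^ 2) +
        ((∫⁻ t in Icc 0 T, ENNReal.ofReal (g t)) + ENNReal.ofReal (f 0)) := by
        gcongr
        exact h.lintegral_ofReal_neg_le hf hT
    _ = _ := by rw [add_comm (∫⁻ t in Icc 0 T, ENNReal.ofReal (g t)), add_assoc]

theorem setLIntegral_Ici_le_add_of_forall_Icc {φ ψ : ℝ → ℝ≥0∞} {c : ℝ≥0∞} {a : ℝ}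
    (h : ∀ b, a ≤ b → ∫⁻ t in Icc a b, φ t ≤ (∫⁻ t in Icc a b, ψ t) + c) :
    ∫⁻ t in Ici a, φ t ≤ (∫⁻ t in Ici a, ψ t) + c := by
  have hunion : Ici a = ⋃ n : ℕ, Icc a (a + n) := by
    ext t
    obtain ⟨n, hn⟩ := exists_nat_ge (t - a)
    simp only [mem_Ici, mem_iUnion, mem_Icc, exists_and_left, iff_self_and]
    exact fun _ => ⟨n, by linarith⟩
  have hmono : Monotone fun n : ℕ => Icc a (a + n) :=
    fun m n hmn => Icc_subset_Icc_right (by gcongr)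
  conv_lhs => rw [hunion, setLIntegral_iUnion_of_directed _ hmono.directed_le]
  refine iSup_le fun n => (h _ (le_add_of_nonneg_right n.cast_nonneg)).trans ?_
  gcongr
  exact Icc_subset_Ici_self

theorem eLpNorm_two_le_add_of_lintegral_enorm_sq_le {α : Type*} [MeasurableSpace α]
    {μ : Measure α} {v : α → X} {y : α → Y} {c : ℝ≥0∞}
    (h : ∫⁻ t, ‖y t‖ₑ ^ 2 ∂μ ≤ (∫⁻ t, ‖v t‖ₑ ^ 2 ∂μ) + c ^ 2) :
    eLpNorm y 2 μ ≤ eLpNorm v 2 μ + c := by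
  have hsq : (c ^ 2) ^ (1 / 2 : ℝ) = c := by
    rw [← ENNReal.rpow_natCast, ← ENNReal.rpow_mul]
    norm_num
  simp only [eLpNorm_eq_lintegral_rpow_enorm_toReal two_ne_zero ENNReal.ofNat_ne_top,
    ENNReal.toReal_ofNat, ENNReal.rpow_ofNat]
  calc _ ≤ ((∫⁻ t, ‖v t‖ₑ ^ 2 ∂μ) + c ^ 2) ^ (1 / 2 : ℝ) := by gcongr
    _ ≤ (∫⁻ t, ‖v t‖ₑ ^ 2 ∂μ) ^ (1 / 2 : ℝ) + (c ^ 2) ^ (1 / 2 : ℝ) :=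
        ENNReal.rpow_add_le_add_rpow _ _ (by norm_num) (by norm_num)
    _ = _ := by rw [hsq]

theorem IsPrimitiveOnIci.eLpNorm_two_le {f g : ℝ → ℝ} (h : IsPrimitiveOnIci f g)
    (hf : ∀ t, 0 ≤ f t) {v : ℝ → X} {y : ℝ → Y} (hg : ∀ t, g t ≤ ‖v t‖ ^ 2 - ‖y t‖ ^ 2)
    {I : Set ℝ} (hI : (∃ T, 0 ≤ T ∧ I = Icc 0 T) ∨ I = Ici 0) :
    eLpNorm y 2 (volume.restrict I) ≤
      eLpNorm v 2 (volume.restrict I) + ENNReal.ofReal √(f 0) := by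
  have hsq : ENNReal.ofReal √(f 0) ^ 2 = ENNReal.ofReal (f 0) := by
    rw [← ENNReal.ofReal_pow (Real.sqrt_nonneg _), Real.sq_sqrt (hf 0)]
  apply eLpNorm_two_le_add_of_lintegral_enorm_sq_le
  rw [hsq]
  rcases hI with ⟨T, hT, rfl⟩ | rfl
  · exact h.lintegral_enorm_sq_le hf hg hT
  · exact setLIntegral_Ici_le_add_of_forall_Icc fun _ => h.lintegral_enorm_sq_le hf hg

end Gain

/-! ## Quadratic forms of symmetric matrices -/

section QuadraticForms

theorem inner_apply_sq_le_of_isPositive {E : Type*} [NormedAddCommGroup E] [InnerProductSpace ℝ E]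
    {T : E →L[ℝ] E} (hT : T.IsPositive) (x y : E) :
    inner ℝ x (T y) ^ 2 ≤ inner ℝ x (T x) * inner ℝ y (T y) := by
  let B : LinearMap.BilinForm ℝ E := (innerₗ E).compl₂ T.toLinearMap
  have hB : ∀ x y, B x y = inner ℝ x (T y) := fun _ _ => rfl
  have hsymm : ∀ x y, B x y = B y x := fun x y => by
    rw [hB, hB, real_inner_comm, hT.isSymmetric.apply_clm y x]
  exact B.apply_sq_le_of_symm hT.inner_nonneg_right ⟨hsymm⟩ x y

variable {n : Type*} [Fintype n] [DecidableEq n] {A : Matrix n n ℝ}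

theorem inner_toEuclideanCLM_transpose (A : Matrix n n ℝ) (x y : EuclideanSpace ℝ n) :
    inner ℝ x (Matrix.toEuclideanCLM (𝕜 := ℝ) A.transpose y) =
      inner ℝ (Matrix.toEuclideanCLM (𝕜 := ℝ) A x) y := by
  rw [← Matrix.conjTranspose_eq_transpose_of_trivial, ← Matrix.star_eq_conjTranspose, map_star,
    ContinuousLinearMap.star_eq_adjoint, ContinuousLinearMap.adjoint_inner_right]

theorem isPositive_toEuclideanCLM (hA : A.PosSemidef) :
    (Matrix.toEuclideanCLM (𝕜 := ℝ) A).IsPositive := by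
  rw [← ContinuousLinearMap.isPositive_toLinearMap_iff,
    Matrix.coe_toEuclideanCLM_eq_toEuclideanLin, Matrix.isPositive_toEuclideanLin_iff]
  exact hA

theorem inner_toEuclideanCLM_le_of_posSemidef_sub {c : ℝ}
    (h : (c • (1 : Matrix n n ℝ) - A).PosSemidef) (x : EuclideanSpace ℝ n) :
    inner ℝ x (Matrix.toEuclideanCLM (𝕜 := ℝ) A x) ≤ c * ‖x‖ ^ 2 := by
  have hnonneg := (isPositive_toEuclideanCLM h).inner_nonneg_right x
  rwa [map_sub, map_smul, map_one, sub_apply, smul_apply,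
    one_apply_eq_self, inner_sub_right, inner_smul_right, real_inner_self_eq_norm_sq,
    sub_nonneg] at hnonneg

open scoped MatrixOrder in
theorem inner_toEuclideanCLM_le_sSup_spectrum (hA : A.IsHermitian) (x : EuclideanSpace ℝ n) :
    inner ℝ x (Matrix.toEuclideanCLM (𝕜 := ℝ) A x) ≤ sSup (spectrum ℝ A) * ‖x‖ ^ 2 := by
  apply inner_toEuclideanCLM_le_of_posSemidef_sub
  rw [← Algebra.algebraMap_eq_smul_one, ← Matrix.le_iff]
  exact le_algebraMap_of_spectrum_le (fun r hr => le_csSup Matrix.finite_real_spectrum.bddAbove hr)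
    hA.isSelfAdjoint

open scoped MatrixOrder in
theorem sInf_spectrum_mul_le_inner_toEuclideanCLM (hA : A.IsHermitian)
    (x : EuclideanSpace ℝ n) :
    sInf (spectrum ℝ A) * ‖x‖ ^ 2 ≤ inner ℝ x (Matrix.toEuclideanCLM (𝕜 := ℝ) A x) := by
  have hneg : (-sInf (spectrum ℝ A) • (1 : Matrix n n ℝ) - -A).PosSemidef := by
    rw [neg_smul, neg_sub_neg, ← Algebra.algebraMap_eq_smul_one, ← Matrix.le_iff]
    exact algebraMap_le_of_le_spectrum
      (fun r hr => csInf_le Matrix.finite_real_spectrum.bddBelow hr) hA.isSelfAdjoint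
  have hle := inner_toEuclideanCLM_le_of_posSemidef_sub hneg x
  rw [map_neg, neg_apply, inner_neg_right, neg_mul] at hle
  exact neg_le_neg_iff.1 hle

theorem inner_toEuclideanCLM_le_sSup_spectrum_mul (hA : A.PosSemidef) (x y : EuclideanSpace ℝ n) :
    inner ℝ x (Matrix.toEuclideanCLM (𝕜 := ℝ) A y) ≤ sSup (spectrum ℝ A) * ‖x‖ * ‖y‖ := by
  have hnonneg : 0 ≤ sSup (spectrum ℝ A) :=
    Real.sSup_nonneg (Matrix.posSemidef_iff_isHermitian_and_spectrum_nonneg.1 hA).2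
  refine le_of_sq_le_sq ?_ (by positivity)
  calc inner ℝ x (Matrix.toEuclideanCLM (𝕜 := ℝ) A y) ^ 2
      ≤ inner ℝ x (Matrix.toEuclideanCLM (𝕜 := ℝ) A x) *
          inner ℝ y (Matrix.toEuclideanCLM (𝕜 := ℝ) A y) :=
        inner_apply_sq_le_of_isPositive (isPositive_toEuclideanCLM hA) x y
    _ ≤ (sSup (spectrum ℝ A) * ‖x‖ ^ 2) * (sSup (spectrum ℝ A) * ‖y‖ ^ 2) :=
        mul_le_mul (inner_toEuclideanCLM_le_sSup_spectrum hA.isHermitian x)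
          (inner_toEuclideanCLM_le_sSup_spectrum hA.isHermitian y)
          ((isPositive_toEuclideanCLM hA).inner_nonneg_right y) (by positivity)
    _ = (sSup (spectrum ℝ A) * ‖x‖ * ‖y‖) ^ 2 := by ring

theorem sInf_spectrum_pos [Nonempty n] (hA : A.PosDef) : 0 < sInf (spectrum ℝ A) := by
  have hspec := hA.isHermitian.spectrum_real_eq_range_eigenvalues
  obtain ⟨i, hi⟩ : sInf (spectrum ℝ A) ∈ range hA.isHermitian.eigenvalues := by
    rw [← hspec]
    exact (hspec ▸ range_nonempty _).csInf_mem Matrix.finite_real_spectrum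
  exact hi ▸ hA.eigenvalues_pos i

theorem sInf_spectrum_le_sSup_spectrum (A : Matrix n n ℝ) :
    sInf (spectrum ℝ A) ≤ sSup (spectrum ℝ A) :=
  Real.sInf_le_sSup _ Matrix.finite_real_spectrum.bddBelow Matrix.finite_real_spectrum.bddAbove

end QuadraticForms

/-! ## The network as a linear system -/

namespace ErrorNetwork

variable {N : ℕ}

/-- The state of one agent, as a continuous linear function of the state of the network. -/
noncomputable def agent (i : Fin N) : NetState N →L[ℝ] BodyState :=
  PiLp.proj (𝕜 := ℝ) 2 (fun _ : Fin N => BodyState) i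

/-- The state matrix of the network, as a linear map: `field` without the disturbance. -/
noncomputable def stateMap (net : ErrorNetwork N) : NetState N →L[ℝ] NetState N :=
  ((PiLp.continuousLinearEquiv 2 ℝ (fun _ : Fin N => BodyState)).symm :
    (Fin N → BodyState) →L[ℝ] NetState N).comp
    (ContinuousLinearMap.pi fun i =>
      (BodyMat.op (outerA + outerB * net.Lbar i)).comp (agent i) +
        ∑ j, (BodyMat.op (net.K i j)).comp (agent j))

theorem field_eq_stateMap_add (net : ErrorNetwork N) (e w : NetState N) :
    net.field e w = net.stateMap e + w := by
  ext i : 1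
  have hrow : net.stateMap e i = BodyMat.op (outerA + outerB * net.Lbar i) (e i) +
      ∑ j, BodyMat.op (net.K i j) (e j) := by
    change ((BodyMat.op (outerA + outerB * net.Lbar i)).comp (agent i) +
      ∑ j, (BodyMat.op (net.K i j)).comp (agent j)) e = _
    simp [agent]
  rw [PiLp.add_apply, hrow, add_assoc]
  rfl

theorem isSolution_iff {net : ErrorNetwork N} {w e : ℝ → NetState N} :
    net.IsSolution w e ↔ IsPrimitiveOnIci e fun t => net.field (e t) (w t) :=
  ⟨fun h => h.2, fun h => ⟨h.continuousOn, h⟩⟩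

theorem exists_isSolution (net : ErrorNetwork N) {w : ℝ → NetState N}
    (hw : ∀ t, 0 ≤ t → IntervalIntegrable w volume 0 t) (e₀ : NetState N) :
    ∃ e, net.IsSolution w e ∧ e 0 = e₀ := by
  simpa only [isSolution_iff, field_eq_stateMap_add] using
    exists_isPrimitiveOnIci_linear_add net.stateMap hw e₀

end ErrorNetwork

/-! ## Finite-gain stability -/

theorem fderiv_sum_const_mul_comp {ι E F : Type*} [Fintype ι] [NormedAddCommGroup E]
    [NormedSpace ℝ E] [NormedAddCommGroup F] [NormedSpace ℝ F] (p : ι → ℝ) {V : ι → F → ℝ}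
    (hV : ∀ i, Differentiable ℝ (V i)) (A : ι → E →L[ℝ] F) (x v : E) :
    fderiv ℝ (fun x => ∑ i, p i * V i (A i x)) x v =
      ∑ i, p i * fderiv ℝ (V i) (A i x) (A i v) := by
  have h : HasFDerivAt (fun x => ∑ i, p i * V i (A i x))
      (∑ i, p i • (fderiv ℝ (V i) (A i x)).comp (A i)) x :=
    HasFDerivAt.fun_sum fun i _ =>
      ((hV i (A i x)).hasFDerivAt.comp x (A i).hasFDerivAt).const_mul (p i)
  rw [h.fderiv]
  simp

theorem nonneg_of_pos_of_ne_zero {E : Type*} [Zero E] {V : E → ℝ} (h0 : V 0 = 0)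
    (hpos : ∀ x, x ≠ 0 → 0 < V x) (x : E) : 0 ≤ V x := by
  rcases eq_or_ne x 0 with rfl | hx
  · exact h0.ge
  · exact (hpos x hx).le

namespace ErrorNetwork

variable {N : ℕ} {net : ErrorNetwork N}

theorem isDissipative_of_sum_mul_le {p : Fin N → ℝ} (hp : ∀ i, 0 < p i)
    {s : Fin N → BodyState → BodyState → ℝ} {σ : NetState N → NetState N → ℝ}
    (hsub : ∀ i, IsDissipative (subsystemField (net.Lbar i)) (fun x _ => x) (s i))
    (hsum : ∀ e w, ∑ i, p i * s i (net.input e w i) (e i) ≤ σ w e) :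
    IsDissipative net.field net.output σ := by
  choose V hV hV0 hVpos hVd using fun i => (hsub i).2.2
  refine ⟨by rw [field_eq_stateMap_add, map_zero, add_zero], rfl,
    fun x => ∑ i, p i * V i (x i), ?_, by simp [hV0], fun x hx => ?_, fun x u => ?_⟩
  · exact ContDiff.sum fun i _ => contDiff_const.mul ((hV i).comp (agent i).contDiff)
  · obtain ⟨i, hi⟩ : ∃ i, x i ≠ 0 := by
      by_contra! hzero
      exact hx (PiLp.ext hzero)
    exact Finset.sum_pos'
      (fun j _ => mul_nonneg (hp j).le (nonneg_of_pos_of_ne_zero (hV0 j) (hVpos j) _))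
      ⟨i, Finset.mem_univ i, mul_pos (hp i) (hVpos i _ hi)⟩
  · calc fderiv ℝ (fun x : NetState N => ∑ i, p i * V i (agent i x)) x (net.field x u)
        = ∑ i, p i * fderiv ℝ (V i) (x i) (subsystemField (net.Lbar i) (x i) (net.input x u i)) :=
          fderiv_sum_const_mul_comp p (fun i => (hV i).differentiable one_ne_zero) agent x _
      _ ≤ ∑ i, p i * s i (net.input x u i) (x i) :=
          Finset.sum_le_sum fun i _ => mul_le_mul_of_nonneg_left (hVd i _ _) (hp i).le
      _ ≤ σ u x := hsum x u

theorem isL2Stable_of_isDissipative {γ : ℝ} (hγ : 0 ≤ γ)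
    (hdiss : IsDissipative net.field net.output (supplyL2G γ)) : net.IsL2Stable γ := by
  refine ⟨hdiss, ?_⟩
  obtain ⟨-, -, V, hV, hV0, hVpos, hVd⟩ := hdiss
  refine ⟨fun x => (√(V x)).toNNReal, by simp [hV0], fun w e he I hI => ?_⟩
  have hrate : ∀ t, fderiv ℝ V (e t) (net.field (e t) (w t)) ≤ ‖γ • w t‖ ^ 2 - ‖e t‖ ^ 2 := by
    intro t
    rw [norm_smul, mul_pow, Real.norm_eq_abs, sq_abs]
    exact hVd (e t) (w t)
  have hgain := ((isSolution_iff.1 he).contDiff_comp hV).eLpNorm_two_le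
    (fun t => nonneg_of_pos_of_ne_zero hV0 hVpos (e t)) hrate hI
  rwa [show (fun t => γ • w t) = γ • w from rfl, eLpNorm_const_smul,
    Real.enorm_of_nonneg hγ] at hgain

end ErrorNetwork

/-! ## The linear matrix inequality -/

section MatrixInequality

open scoped Matrix

/-- The coordinates of a stacked vector, indexed like the rows of `stackBlocks`. -/
def stackCoords {N : ℕ} (e : NetState N) (ia : Fin N × BodyIdx) : ℝ := e ia.1 ia.2

theorem stackBlocks_mulVec_stackCoords {N : ℕ} (Q : Fin N → Fin N → BodyMat) (e : NetState N)
    (i : Fin N) (a : BodyIdx) :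
    (stackBlocks Q *ᵥ stackCoords e) (i, a) = (∑ j, BodyMat.op (Q i j) (e j)) a := by
  simp [Matrix.mulVec, dotProduct, stackBlocks, stackCoords, Fintype.sum_prod_type]

theorem sum_mul_supplyIFOFP_eq_sum_stackCoords {N : ℕ} (p ν ρ : Fin N → ℝ) (η e : NetState N) :
    ∑ i, p i * supplyIFOFP (ν i) (ρ i) (η i) (e i) =
      ∑ ia, p ia.1 * (-ν ia.1 * stackCoords η ia ^ 2 + stackCoords η ia * stackCoords e ia -
        ρ ia.1 * stackCoords e ia ^ 2) := by
  simp only [supplyIFOFP, EuclideanSpace.real_norm_sq_eq, PiLp.inner_apply, RCLike.inner_apply,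
    conj_trivial, mul_comm (e _ _), Finset.mul_sum, ← Finset.sum_add_distrib,
    ← Finset.sum_sub_distrib, Fintype.sum_prod_type, stackCoords]

theorem supplyL2G_eq_sum_stackCoords {N : ℕ} (γ : ℝ) (w e : NetState N) :
    supplyL2G γ w e = ∑ ia, (γ ^ 2 * stackCoords w ia ^ 2 - stackCoords e ia ^ 2) := by
  simp only [supplyL2G, PiLp.norm_sq_eq_of_L2, Finset.mul_sum, ← Finset.sum_sub_distrib,
    Real.norm_eq_abs, sq_abs, stackCoords, Fintype.sum_prod_type]

namespace DesignData

variable {N : ℕ} {S : DesignData N} {D : DesignVars N}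

theorem neg_p_mul_ν_pos_of_lmiMatrix_posDef (h : (S.lmiMatrix D).PosDef) (i : Fin N) :
    0 < -(D.p i * S.ν i) := by
  simpa [lmiMatrix, Xp11, scalarBlocks] using
    h.diag_pos (i := Sum.inl (Sum.inl (i, Sum.inl 0)))

theorem closedLoop_K (hpν : ∀ i, 0 < -(D.p i * S.ν i)) (i j : Fin N) :
    (S.closedLoop D).K i j = (-(D.p i * S.ν i))⁻¹ • D.Q i j := by
  have hinv : (S.Xp11 D)⁻¹ = scalarBlocks fun i => (-(D.p i * S.ν i))⁻¹ := by
    refine Matrix.inv_eq_right_inv ?_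
    rw [Xp11, scalarBlocks, scalarBlocks, Matrix.diagonal_mul_diagonal, ← Matrix.diagonal_one]
    exact congrArg _ (funext fun ia => mul_inv_cancel₀ (hpν ia.1).ne')
  ext a b
  simp [closedLoop, hinv, scalarBlocks, stackBlocks, Matrix.diagonal_mul]

theorem stackBlocks_mulVec_eq_of_input (hpν : ∀ i, 0 < -(D.p i * S.ν i)) (e w : NetState N)
    (ia : Fin N × BodyIdx) :
    (stackBlocks D.Q *ᵥ stackCoords e) ia = -(D.p ia.1 * S.ν ia.1) *
      (stackCoords (WithLp.toLp 2 ((S.closedLoop D).input e w)) ia - stackCoords w ia) := by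
  obtain ⟨i, a⟩ := ia
  simp only [stackBlocks_mulVec_stackCoords, stackCoords, ErrorNetwork.input, closedLoop_K hpν,
    BodyMat.op, map_smul, smul_apply, ← Finset.smul_sum, PiLp.add_apply, PiLp.smul_apply,
    smul_eq_mul, add_sub_cancel_right]
  rw [mul_inv_cancel_left₀ (hpν i).ne']

-- `hη` says `𝐗_p¹¹ η = Q x + 𝐗_p¹¹ u`, which makes the first two block rows of the matrix vanish
-- on `(-η, -x, x, u)`: the Schur complement is evaluated without being formed.
theorem dotProduct_lmiMatrix_mulVec (hν : ∀ i, S.ν i ≠ 0) {η x u : Fin N × BodyIdx → ℝ}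
    (hη : ∀ ia, (stackBlocks D.Q *ᵥ x) ia = -(D.p ia.1 * S.ν ia.1) * (η ia - u ia)) :
    Sum.elim (Sum.elim (-η) (-x)) (Sum.elim x u) ⬝ᵥ
        (S.lmiMatrix D *ᵥ Sum.elim (Sum.elim (-η) (-x)) (Sum.elim x u)) =
      ∑ ia, (D.γ ^ 2 * u ia ^ 2 - x ia ^ 2) -
        ∑ ia, D.p ia.1 * (-S.ν ia.1 * η ia ^ 2 + η ia * x ia - S.ρ ia.1 * x ia ^ 2) := by
  have hT : ∀ v, x ⬝ᵥ ((stackBlocks D.Q).transpose *ᵥ v) = (stackBlocks D.Q *ᵥ x) ⬝ᵥ v :=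
    fun v => by rw [Matrix.dotProduct_mulVec, Matrix.vecMul_transpose]
  simp only [lmiMatrix, Matrix.fromBlocks_mulVec, ← Sum.elim_add_add, Sum.elim_comp_inl,
    Sum.elim_comp_inr, dotProduct_add, sumElim_dotProduct_sumElim, Matrix.sub_mulVec,
    Matrix.neg_mulVec, ← Matrix.mulVec_mulVec, dotProduct_sub, dotProduct_neg, hT,
    Matrix.smul_mulVec, Matrix.one_mulVec, Matrix.zero_mulVec]
  simp only [Xp11, Xp22, X12, X21, scalarBlocks, Matrix.diagonal_transpose, dotProduct,
    Matrix.mulVec_diagonal, Pi.smul_apply, Pi.zero_apply, Pi.neg_apply, smul_eq_mul, hη,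
    ← Finset.sum_add_distrib, ← Finset.sum_sub_distrib, ← Finset.sum_neg_distrib]
  refine Finset.sum_congr rfl fun ia _ => ?_
  have := hν ia.1
  field_simp
  ring

theorem sum_supplyIFOFP_le_supplyL2G (h : (S.lmiMatrix D).PosDef) (e w : NetState N) :
    ∑ i, D.p i * supplyIFOFP (S.ν i) (S.ρ i) ((S.closedLoop D).input e w i) (e i) ≤
      supplyL2G D.γ w e := by
  have hpν := neg_p_mul_ν_pos_of_lmiMatrix_posDef h
  have hν : ∀ i, S.ν i ≠ 0 := fun i hi => (hpν i).ne' (by rw [hi, mul_zero, neg_zero])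
  have hform := dotProduct_lmiMatrix_mulVec hν (stackBlocks_mulVec_eq_of_input hpν e w)
  have hnonneg := h.posSemidef.dotProduct_mulVec_nonneg (Sum.elim
    (Sum.elim (-stackCoords (WithLp.toLp 2 ((S.closedLoop D).input e w))) (-stackCoords e))
    (Sum.elim (stackCoords e) (stackCoords w)))
  rw [star_trivial, hform, ← supplyL2G_eq_sum_stackCoords,
    ← sum_mul_supplyIFOFP_eq_sum_stackCoords, sub_nonneg] at hnonneg
  exact hnonneg

theorem isL2Stable_closedLoop (hγ : 0 ≤ D.γ) (hp : ∀ i, 0 < D.p i)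
    (hifofp : ∀ i, IsDissipative (subsystemField (S.Lbar i)) (fun x _ => x)
      (supplyIFOFP (S.ν i) (S.ρ i)))
    (hlmi : (S.lmiMatrix D).PosDef) : (S.closedLoop D).IsL2Stable D.γ :=
  ErrorNetwork.isL2Stable_of_isDissipative hγ <|
    ErrorNetwork.isDissipative_of_sum_mul_le hp hifofp (sum_supplyIFOFP_le_supplyL2G hlmi)

end DesignData

end MatrixInequality

/-! ## Vector comparison of coupled rates -/

-- Just below the envelope `a e^{-αt} + d` the negative part of the rate outweighs the coupling by
-- half of the margin `1 - θ`, and that half pays for the decay of the envelope.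
theorem lt_exp_of_rate_le {ι : Type*} [Finite ι] {Y g : ι → ℝ → ℝ} {m : ι → ℝ} {κ θ c a : ℝ}
    (hκ : 0 < κ) (hθ : θ < 1) (hc : 0 ≤ c) (ha : 0 < a) (hY : ∀ i, IsPrimitiveOnIci (Y i) (g i))
    (hm : ∀ i, κ ≤ m i) (h0 : ∀ i, Y i 0 < a)
    (hrate : ∀ i t B, 0 ≤ t → (∀ j, Y j t ≤ B) → g i t ≤ m i * (-Y i t + θ * B + c))
    (i : ι) {t : ℝ} (ht : 0 ≤ t) :
    Y i t < a * Real.exp (-(κ * (1 - θ) / 2) * t) + 2 * c / (1 - θ) := by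
  have hθ' : 0 < 1 - θ := sub_pos.2 hθ
  set α := κ * (1 - θ) / 2 with hα
  set d := 2 * c / (1 - θ) with hd
  have hd0 : 0 ≤ d := by positivity
  have hcd : c = (1 - θ) / 2 * d := by rw [hd]; field_simp
  have hB_deriv : ∀ s, HasDerivAt (fun s => -(a * Real.exp (-α * s) + d))
      (α * (a * Real.exp (-α * s))) s := by
    intro s
    have hlin : HasDerivAt (fun s : ℝ => -α * s) (-α) s := by
      simpa using (hasDerivAt_id s).const_mul (-α)
    exact ((hlin.exp.const_mul a).add_const d).neg.congr_deriv (by ring)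
  have hf : ∀ i, IsPrimitiveOnIci (fun s => Y i s + -(a * Real.exp (-α * s) + d))
      (fun s => g i s + α * (a * Real.exp (-α * s))) := fun i =>
    (hY i).add (IsPrimitiveOnIci.of_hasDerivAt hB_deriv (by fun_prop))
  rw [← sub_neg, sub_eq_add_neg]
  refine neg_of_rate_nonpos_near_zero
    (lo := fun _ s => -((1 - θ) / 2 * (a * Real.exp (-α * s) + d))) hf
    (fun _ => by fun_prop) (fun _ s _ => neg_neg_of_pos (by positivity)) (fun j => ?_)
    (fun j s hs hle hlo => ?_) i ht
  · rw [mul_zero, Real.exp_zero, mul_one]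
    linarith [h0 j]
  · have hbelow : ∀ k, Y k s ≤ a * Real.exp (-α * s) + d := fun k => by linarith [hle k]
    have hgap : -Y j s + θ * (a * Real.exp (-α * s) + d) + c ≤
        -((1 - θ) / 2 * (a * Real.exp (-α * s))) := by
      rw [hcd]
      linarith
    calc g j s + α * (a * Real.exp (-α * s))
        ≤ m j * -((1 - θ) / 2 * (a * Real.exp (-α * s))) + α * (a * Real.exp (-α * s)) := by
          gcongr
          exact (hrate j s _ hs hbelow).trans
            (mul_le_mul_of_nonneg_left hgap (hκ.le.trans (hm j)))
      _ = -(m j - κ) * ((1 - θ) / 2 * (a * Real.exp (-α * s))) := by rw [hα]; ring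
      _ ≤ 0 := mul_nonpos_of_nonpos_of_nonneg (neg_nonpos.2 (sub_nonneg.2 (hm j)))
          (by positivity)

theorem le_exp_of_rate_le {ι : Type*} [Finite ι] {Y g : ι → ℝ → ℝ} {m : ι → ℝ} {κ θ c a : ℝ}
    (hκ : 0 < κ) (hθ : θ < 1) (hc : 0 ≤ c) (ha : 0 ≤ a) (hY : ∀ i, IsPrimitiveOnIci (Y i) (g i))
    (hm : ∀ i, κ ≤ m i) (h0 : ∀ i, Y i 0 ≤ a)
    (hrate : ∀ i t B, 0 ≤ t → (∀ j, Y j t ≤ B) → g i t ≤ m i * (-Y i t + θ * B + c))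
    (i : ι) {t : ℝ} (ht : 0 ≤ t) :
    Y i t ≤ a * Real.exp (-(κ * (1 - θ) / 2) * t) + 2 * c / (1 - θ) := by
  refine le_of_forall_pos_lt_add fun ε hε => ?_
  have hα : 0 ≤ κ * (1 - θ) / 2 * t :=
    mul_nonneg (div_nonneg (mul_nonneg hκ.le (sub_nonneg.2 hθ.le)) zero_le_two) ht
  have hexp : Real.exp (-(κ * (1 - θ) / 2) * t) ≤ 1 :=
    Real.exp_le_one_iff.2 (by rw [neg_mul]; exact neg_nonpos.2 hα)
  have hlt := lt_exp_of_rate_le hκ hθ hc (add_pos_of_nonneg_of_pos ha hε) hY hm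
    (fun i => (h0 i).trans_lt (lt_add_of_pos_right a hε)) hrate i ht
  linarith [mul_le_mul_of_nonneg_left hexp hε.le]

theorem IsPrimitiveOnIci.inner_clm_apply_self {E F : Type*} [NormedAddCommGroup E]
    [NormedSpace ℝ E] [CompleteSpace E] [NormedAddCommGroup F] [InnerProductSpace ℝ F]
    {e g : ℝ → E} (h : IsPrimitiveOnIci e g) (L : E →L[ℝ] F) {T : F →L[ℝ] F}
    (hT : (T : F →ₗ[ℝ] F).IsSymmetric) :
    IsPrimitiveOnIci (fun t => inner ℝ (L (e t)) (T (L (e t))))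
      fun t => 2 * inner ℝ (L (e t)) (T (L (g t))) := by
  have hV : ContDiff ℝ 1 fun x => inner ℝ (L x) (T (L x)) :=
    L.contDiff.inner ℝ (T.contDiff.comp L.contDiff)
  refine (h.contDiff_comp hV).congr fun t _ => ?_
  have hderiv : HasFDerivAt (fun x => inner ℝ (L x) (T (L x))) _ (e t) :=
    L.hasFDerivAt.inner ℝ (T.comp L).hasFDerivAt
  have hsymm : inner ℝ (L (g t)) (T (L (e t))) = inner ℝ (L (e t)) (T (L (g t))) := by
    rw [real_inner_comm]
    exact hT _ _
  rw [hderiv.fderiv]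
  simp only [ContinuousLinearMap.comp_apply, ContinuousLinearMap.prod_apply,
    fderivInnerCLM_apply, hsymm, two_mul]

/-! ## Weakly coupled networks -/

theorem mul_add_sq_le {θ : ℝ} (hθ0 : 0 ≤ θ) (hθ1 : θ < 1) (a b : ℝ) :
    (θ * a + b) ^ 2 ≤ θ * a ^ 2 + b ^ 2 / (1 - θ) := by
  have hθ : 0 < 1 - θ := sub_pos.2 hθ1
  have hdiff : θ * a ^ 2 + b ^ 2 / (1 - θ) - (θ * a + b) ^ 2 =
      θ * ((1 - θ) * a - b) ^ 2 / (1 - θ) := by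
    field_simp
    ring
  exact sub_nonneg.1 (hdiff ▸ by positivity)

/-- The energy `⟪x, R x⟫` of an agent, scaled so that it dominates `‖x‖²`: in this form the energies
of agents with different `R_i` can be compared. -/
noncomputable def normalizedEnergy (R : BodyMat) (x : BodyState) : ℝ :=
  (lambdaMin R)⁻¹ * inner ℝ x (BodyMat.op R x)

theorem norm_sq_le_normalizedEnergy {R : BodyMat} (hR : R.PosDef) (x : BodyState) :
    ‖x‖ ^ 2 ≤ normalizedEnergy R x :=
  (le_inv_mul_iff₀ (sInf_spectrum_pos hR)).2
    (sInf_spectrum_mul_le_inner_toEuclideanCLM hR.isHermitian x)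

theorem normalizedEnergy_le {R : BodyMat} (hR : R.PosSemidef) {κ M : ℝ} (hκ : 0 < κ)
    (hmin : κ ≤ lambdaMin R) (hmax : lambdaMax R ≤ M) (x : BodyState) :
    normalizedEnergy R x ≤ M / κ * ‖x‖ ^ 2 :=
  calc (lambdaMin R)⁻¹ * inner ℝ x (BodyMat.op R x) ≤ κ⁻¹ * (M * ‖x‖ ^ 2) :=
        mul_le_mul (inv_anti₀ hκ hmin)
          ((inner_toEuclideanCLM_le_sSup_spectrum hR.isHermitian x).trans
            (mul_le_mul_of_nonneg_right hmax (sq_nonneg _)))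
          ((isPositive_toEuclideanCLM hR).inner_nonneg_right x) (inv_pos.2 hκ).le
    _ = M / κ * ‖x‖ ^ 2 := by ring

namespace ErrorNetwork

variable {N : ℕ}

/-- The small-gain condition behind mesh stability. The energy `⟪x, R_i x⟫` of an isolated agent
decays with rate `μ_i`, with a surplus `‖x‖²` to absorb the coupling to its neighbours and the
disturbance, and the coupling gain is at most `θ δ_i` with `δ_i = √(μ_i λ_min(R_i))`. The constants
`κ`, `M`, `θ` are common to all agents. -/
structure IsWeaklyCoupled (net : ErrorNetwork N) (R : Fin N → BodyMat) (μ : Fin N → ℝ)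
    (κ M θ : ℝ) : Prop where
  R_posDef : ∀ i, (R i).PosDef
  le_lambdaMin : ∀ i, κ ≤ lambdaMin (R i)
  lambdaMax_le : ∀ i, lambdaMax (R i) ≤ M
  le_rate : ∀ i, κ ≤ μ i
  decay : ∀ i x, 2 * inner ℝ x (BodyMat.op (R i) (BodyMat.op (outerA + outerB * net.Lbar i) x +
    BodyMat.op (net.K i i) x)) ≤ -(μ i * lambdaMax (R i) + 1) * ‖x‖ ^ 2
  coupling : ∀ i, ∑ j ∈ Finset.univ.erase i, specNorm (R i * net.K i j) ≤
    θ * √(μ i * lambdaMin (R i))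

theorem inner_sum_op_le (net : ErrorNetwork N) (R : BodyMat) (i : Fin N) {e : NetState N} {s : ℝ}
    (he : ∀ j, ‖e j‖ ≤ s) (x : BodyState) :
    inner ℝ x (BodyMat.op R (∑ j ∈ Finset.univ.erase i, BodyMat.op (net.K i j) (e j))) ≤
      ‖x‖ * ((∑ j ∈ Finset.univ.erase i, specNorm (R * net.K i j)) * s) := by
  refine (real_inner_le_norm _ _).trans (mul_le_mul_of_nonneg_left ?_ (norm_nonneg x))
  rw [map_sum, Finset.sum_mul]
  refine norm_sum_le_of_le _ fun j _ => ?_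
  calc ‖BodyMat.op R (BodyMat.op (net.K i j) (e j))‖ = ‖BodyMat.op (R * net.K i j) (e j)‖ := by
        rw [BodyMat.op, BodyMat.op, BodyMat.op, map_mul, mul_apply_eq_comp]
    _ ≤ specNorm (R * net.K i j) * s :=
        ContinuousLinearMap.le_opNorm_of_le _ (he j)

namespace IsWeaklyCoupled

variable {net : ErrorNetwork N} {R : Fin N → BodyMat} {μ : Fin N → ℝ} {κ M θ : ℝ}

theorem two_mul_inner_field_le (h : net.IsWeaklyCoupled R μ κ M θ) {e w : NetState N} {B ω : ℝ}
    {i : Fin N} (hκ : 0 < κ) (hB : ∀ j, ‖e j‖ ^ 2 ≤ B) (hω : ‖w i‖ ≤ ω) :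
    2 * inner ℝ (e i) (BodyMat.op (R i) (net.field e w i)) ≤
      -(μ i * inner ℝ (e i) (BodyMat.op (R i) (e i))) +
        (θ * √(μ i * lambdaMin (R i) * B) + lambdaMax (R i) * ω) ^ 2 := by
  have hR := (h.R_posDef i).posSemidef
  have hmax : 0 ≤ lambdaMax (R i) :=
    hκ.le.trans ((h.le_lambdaMin i).trans (sInf_spectrum_le_sSup_spectrum (R i)))
  have hμ : 0 ≤ μ i := hκ.le.trans (h.le_rate i)
  have hfield : net.field e w i = BodyMat.op (outerA + outerB * net.Lbar i) (e i) +
      BodyMat.op (net.K i i) (e i) +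
      ∑ j ∈ Finset.univ.erase i, BodyMat.op (net.K i j) (e j) + w i := by
    rw [add_assoc _ (BodyMat.op (net.K i i) (e i)), Finset.add_sum_erase _
      (fun j => BodyMat.op (net.K i j) (e j)) (Finset.mem_univ i), add_assoc]
    rfl
  have hneighbours : inner ℝ (e i) (BodyMat.op (R i)
      (∑ j ∈ Finset.univ.erase i, BodyMat.op (net.K i j) (e j))) ≤
      ‖e i‖ * (θ * √(μ i * lambdaMin (R i) * B)) := by
    refine (net.inner_sum_op_le (R i) i (fun j => Real.le_sqrt_of_sq_le (hB j)) (e i)).trans ?_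
    rw [Real.sqrt_mul' _ ((sq_nonneg _).trans (hB i)), ← mul_assoc θ]
    gcongr
    exact h.coupling i
  have hdisturbance : inner ℝ (e i) (BodyMat.op (R i) (w i)) ≤
      ‖e i‖ * (lambdaMax (R i) * ω) :=
    calc inner ℝ (e i) (BodyMat.op (R i) (w i)) ≤ lambdaMax (R i) * ‖e i‖ * ‖w i‖ :=
          inner_toEuclideanCLM_le_sSup_spectrum_mul hR (e i) (w i)
      _ ≤ lambdaMax (R i) * ‖e i‖ * ω := by gcongr
      _ = ‖e i‖ * (lambdaMax (R i) * ω) := by ring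
  have henergy : μ i * inner ℝ (e i) (BodyMat.op (R i) (e i)) ≤
      μ i * (lambdaMax (R i) * ‖e i‖ ^ 2) :=
    mul_le_mul_of_nonneg_left (inner_toEuclideanCLM_le_sSup_spectrum hR.isHermitian (e i)) hμ
  rw [hfield, map_add, map_add, inner_add_right, inner_add_right]
  linarith [h.decay i (e i), two_mul_le_add_sq ‖e i‖
    (θ * √(μ i * lambdaMin (R i) * B) + lambdaMax (R i) * ω)]

theorem normalizedEnergy_rate_le (h : net.IsWeaklyCoupled R μ κ M θ) (hκ : 0 < κ) (hθ0 : 0 ≤ θ)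
    (hθ1 : θ < 1) {e w : NetState N} {B ω : ℝ} {i : Fin N} (hω : ‖w i‖ ≤ ω)
    (hB : ∀ j, normalizedEnergy (R j) (e j) ≤ B) :
    (lambdaMin (R i))⁻¹ * (2 * inner ℝ (e i) (BodyMat.op (R i) (net.field e w i))) ≤
      μ i * (-normalizedEnergy (R i) (e i) + θ * B + M ^ 2 * ω ^ 2 / ((1 - θ) * κ ^ 2)) := by
  have hθ : 0 < 1 - θ := sub_pos.2 hθ1
  have hmin : 0 < lambdaMin (R i) := hκ.trans_le (h.le_lambdaMin i)
  have hmax : 0 ≤ lambdaMax (R i) := hmin.le.trans (sInf_spectrum_le_sSup_spectrum (R i))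
  have hμ : 0 < μ i := hκ.trans_le (h.le_rate i)
  have hω0 : 0 ≤ ω := (norm_nonneg _).trans hω
  have he : ∀ j, ‖e j‖ ^ 2 ≤ B := fun j =>
    (norm_sq_le_normalizedEnergy (h.R_posDef j) _).trans (hB j)
  have hB0 : 0 ≤ B := (sq_nonneg _).trans (he i)
  have hsplit := mul_add_sq_le hθ0 hθ1 √(μ i * lambdaMin (R i) * B) (lambdaMax (R i) * ω)
  rw [Real.sq_sqrt (by positivity)] at hsplit
  have hdisturbance : (lambdaMax (R i) * ω) ^ 2 / (1 - θ) ≤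
      lambdaMin (R i) * (μ i * (M ^ 2 * ω ^ 2 / ((1 - θ) * κ ^ 2))) :=
    calc (lambdaMax (R i) * ω) ^ 2 / (1 - θ) ≤ (M * ω) ^ 2 / (1 - θ) := by
          gcongr
          exact h.lambdaMax_le i
      _ = κ * (κ * (M ^ 2 * ω ^ 2 / ((1 - θ) * κ ^ 2))) := by field_simp
      _ ≤ lambdaMin (R i) * (μ i * (M ^ 2 * ω ^ 2 / ((1 - θ) * κ ^ 2))) := by
          gcongr
          · exact h.le_lambdaMin i
          · exact h.le_rate i
  rw [inv_mul_le_iff₀ hmin]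
  calc 2 * inner ℝ (e i) (BodyMat.op (R i) (net.field e w i))
      ≤ -(μ i * inner ℝ (e i) (BodyMat.op (R i) (e i))) + (θ * (μ i * lambdaMin (R i) * B) +
          lambdaMin (R i) * (μ i * (M ^ 2 * ω ^ 2 / ((1 - θ) * κ ^ 2)))) := by
        linarith [h.two_mul_inner_field_le hκ he hω]
    _ = lambdaMin (R i) * (μ i * (-normalizedEnergy (R i) (e i) + θ * B +
          M ^ 2 * ω ^ 2 / ((1 - θ) * κ ^ 2))) := by
        rw [normalizedEnergy]
        field_simp
        ring

theorem norm_sq_le (h : net.IsWeaklyCoupled R μ κ M θ) (hκ : 0 < κ) (hθ0 : 0 ≤ θ) (hθ1 : θ < 1)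
    (hM : 0 ≤ M) {w e : ℝ → NetState N} (he : net.IsSolution w e) {r ω : ℝ}
    (hr : ∀ i, ‖e 0 i‖ ≤ r) (hω : ∀ t, 0 ≤ t → ∀ i, ‖w t i‖ ≤ ω) (i : Fin N) {t : ℝ}
    (ht : 0 ≤ t) :
    ‖e t i‖ ^ 2 ≤ M / κ * r ^ 2 * Real.exp (-(κ * (1 - θ) / 2) * t) +
      2 * (M ^ 2 * ω ^ 2 / ((1 - θ) * κ ^ 2)) / (1 - θ) := by
  have : 0 < 1 - θ := sub_pos.2 hθ1
  have henergy : ∀ i, IsPrimitiveOnIci (fun s => normalizedEnergy (R i) (e s i))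
      fun s => (lambdaMin (R i))⁻¹ *
        (2 * inner ℝ (e s i) (BodyMat.op (R i) (net.field (e s) (w s) i))) := fun i =>
    ((isSolution_iff.1 he).inner_clm_apply_self (agent i)
      (isPositive_toEuclideanCLM (h.R_posDef i).posSemidef).isSymmetric).const_smul _
  refine (norm_sq_le_normalizedEnergy (h.R_posDef i) (e t i)).trans
    (le_exp_of_rate_le hκ hθ1 (by positivity) (by positivity) henergy h.le_rate (fun i => ?_)
      (fun i s B hs hB => h.normalizedEnergy_rate_le hκ hθ0 hθ1 (hω s hs i) hB) i ht)
  refine (normalizedEnergy_le (h.R_posDef i).posSemidef hκ (h.le_lambdaMin i) (h.lambdaMax_le i)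
    (e 0 i)).trans ?_
  gcongr
  exact hr i

theorem norm_le (h : net.IsWeaklyCoupled R μ κ M θ) (hκ : 0 < κ) (hθ0 : 0 ≤ θ) (hθ1 : θ < 1)
    (hM : 0 ≤ M) {w e : ℝ → NetState N} (he : net.IsSolution w e) {r ω : ℝ}
    (hr : ∀ i, ‖e 0 i‖ ≤ r) (hω : ∀ t, 0 ≤ t → ∀ i, ‖w t i‖ ≤ ω) (i : Fin N) {t : ℝ}
    (ht : 0 ≤ t) :
    ‖e t i‖ ≤ √(M / κ) * r * Real.exp (-(κ * (1 - θ) / 4) * t) +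
      √2 * M / ((1 - θ) * κ) * ω := by
  have hθ : 0 < 1 - θ := sub_pos.2 hθ1
  have hr0 : 0 ≤ r := (norm_nonneg _).trans (hr i)
  have hω0 : 0 ≤ ω := (norm_nonneg _).trans (hω 0 le_rfl i)
  have hexp : Real.exp (-(κ * (1 - θ) / 2) * t) = Real.exp (-(κ * (1 - θ) / 4) * t) ^ 2 := by
    rw [← Real.exp_nat_mul]
    congr 1
    push_cast
    ring
  refine le_of_sq_le_sq ?_ (by positivity)
  calc ‖e t i‖ ^ 2 ≤ M / κ * r ^ 2 * Real.exp (-(κ * (1 - θ) / 2) * t) +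
        2 * (M ^ 2 * ω ^ 2 / ((1 - θ) * κ ^ 2)) / (1 - θ) :=
        h.norm_sq_le hκ hθ0 hθ1 hM he hr hω i ht
    _ = (√(M / κ) * r * Real.exp (-(κ * (1 - θ) / 4) * t)) ^ 2 +
        (√2 * M / ((1 - θ) * κ) * ω) ^ 2 := by
        rw [hexp, mul_pow, mul_pow, Real.sq_sqrt (by positivity), mul_pow, div_pow, mul_pow,
          Real.sq_sqrt zero_le_two]
        field_simp
    _ ≤ (√(M / κ) * r * Real.exp (-(κ * (1 - θ) / 4) * t) +
        √2 * M / ((1 - θ) * κ) * ω) ^ 2 :=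
        pow_add_pow_le (by positivity) (by positivity) two_ne_zero

end IsWeaklyCoupled

end ErrorNetwork

/-! ## Mesh stability -/

theorem isClassKL_mul_exp {c α : ℝ} (hc : 0 < c) (hα : 0 < α) :
    IsClassKL fun r t => c * r * Real.exp (-α * t) := by
  refine ⟨fun t _ => ⟨by fun_prop, fun x _ y _ hxy => ?_, by simp⟩, fun r hr => ⟨?_, ?_⟩⟩
  · dsimp only
    gcongr
  · intro s _ t _ hst
    have : -α * t ≤ -α * s := mul_le_mul_of_nonpos_left hst (neg_nonpos.2 hα.le)
    dsimp only
    gcongr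
  · have hlin : Tendsto (fun t : ℝ => -α * t) atTop atBot :=
      tendsto_id.const_mul_atTop_of_neg (neg_neg_of_pos hα)
    simpa using (Real.tendsto_exp_atBot.comp hlin).const_mul (c * r)

theorem isClassKInf_const_mul {c : ℝ} (hc : 0 < c) : IsClassKInf fun r => c * r := by
  refine ⟨⟨by fun_prop, fun x _ y _ hxy => ?_, by simp⟩, tendsto_id.const_mul_atTop hc⟩
  dsimp only
  gcongr

theorem intervalIntegrable_of_bddAbove_norm_apply {N : ℕ} {w : ℝ → NetState N}
    (hw : AEStronglyMeasurable w (volume.restrict (Ici 0)))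
    (hb : ∀ i, BddAbove (range fun t : Ici (0 : ℝ) => ‖w t i‖)) {t : ℝ} (ht : 0 ≤ t) :
    IntervalIntegrable w volume 0 t := by
  choose C hC using hb
  have hsub : Ioc 0 t ⊆ Ici 0 := fun _ hs => hs.1.le
  rw [intervalIntegrable_iff_integrableOn_Ioc_of_le ht]
  refine .of_bound measure_Ioc_lt_top (hw.mono_set hsub) √(∑ i, C i ^ 2) ?_
  filter_upwards [ae_restrict_mem measurableSet_Ioc] with s hs
  rw [PiLp.norm_eq_of_L2]
  exact Real.sqrt_le_sqrt (Finset.sum_le_sum fun i _ =>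
    pow_le_pow_left₀ (norm_nonneg _) (hC i ⟨⟨s, hsub hs⟩, rfl⟩) 2)

theorem isScalableMeshStable_of_isWeaklyCoupled {Λ : Type*} {N : Λ → ℕ}
    {net : ∀ l, ErrorNetwork (N l)} {R : ∀ l, Fin (N l) → BodyMat} {μ : ∀ l, Fin (N l) → ℝ}
    {κ M θ : ℝ} (hκ : 0 < κ) (hM : 0 < M) (hθ0 : 0 ≤ θ) (hθ1 : θ < 1)
    (h : ∀ l, (net l).IsWeaklyCoupled (R l) (μ l) κ M θ) : IsScalableMeshStable N net := by
  have : 0 < 1 - θ := sub_pos.2 hθ1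
  refine ⟨fun r t => √(M / κ) * r * Real.exp (-(κ * (1 - θ) / 4) * t),
    fun ω => √2 * M / ((1 - θ) * κ) * ω, 1, 1, isClassKL_mul_exp (by positivity) (by positivity),
    isClassKInf_const_mul (by positivity), one_pos, one_pos, fun l e₀ w hwm hwb _ _ =>
    ⟨(net l).exists_isSolution (fun t ht => intervalIntegrable_of_bddAbove_norm_apply hwm hwb ht)
      e₀, ?_⟩⟩
  rintro e he rfl t ht
  have hr : ∀ i, ‖e 0 i‖ ≤ ⨆ i, ‖e 0 i‖ := le_ciSup (finite_range fun i => ‖e 0 i‖).bddAbove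
  have hω : ∀ t, 0 ≤ t → ∀ i, ‖w t i‖ ≤ ⨆ i, ⨆ t : Ici (0 : ℝ), ‖w t i‖ := fun t ht i =>
    (le_ciSup (hwb i) ⟨t, ht⟩).trans
      (le_ciSup (finite_range fun i => ⨆ t : Ici (0 : ℝ), ‖w t i‖).bddAbove i)
  refine Real.iSup_le (fun i => (h l).norm_le hκ hθ0 hθ1 hM.le he hr hω i ht) ?_
  have hr0 : 0 ≤ ⨆ i, ‖e 0 i‖ := Real.iSup_nonneg fun i => norm_nonneg _
  have hω0 : 0 ≤ ⨆ i, ⨆ t : Ici (0 : ℝ), ‖w t i‖ :=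
    Real.iSup_nonneg fun i => Real.iSup_nonneg fun t => norm_nonneg _
  positivity

/-! ## The closed loop -/

theorem inner_op_symSum (A : BodyMat) (x : BodyState) :
    inner ℝ x (BodyMat.op (symSum A) x) = 2 * inner ℝ x (BodyMat.op A x) := by
  rw [symSum, BodyMat.op, map_add, add_apply, inner_add_right, inner_toEuclideanCLM_transpose,
    real_inner_comm, two_mul]

namespace DesignData

variable {N : ℕ} {S : DesignData N} {D : DesignVars N}

theorem μ_pos {i : Fin N} (hR : (S.R i).PosDef) (hδ : 0 < S.δ i) : 0 < S.μ i :=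
  pos_of_mul_pos_left (Real.sqrt_pos.1 hδ) (sInf_spectrum_pos hR).le

theorem μ_mul_lambdaMax {i : Fin N} (hR : (S.R i).PosDef) :
    S.μ i * lambdaMax (S.R i) = S.ρ i + S.ε i - 1 :=
  div_mul_cancel₀ _
    ((sInf_spectrum_pos hR).trans_le (sInf_spectrum_le_sSup_spectrum (S.R i))).ne'

theorem two_mul_inner_op_stateMatrix_le {i : Fin N} (hR : (S.R i).PosDef)
    (hlyap : (-(S.ρ i) • (1 : BodyMat) -
      symSum ((outerA + outerB * S.Lbar i).transpose * S.R i)).PosSemidef) (x : BodyState) :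
    2 * inner ℝ x (BodyMat.op (S.R i) (BodyMat.op (outerA + outerB * S.Lbar i) x)) ≤
      -S.ρ i * ‖x‖ ^ 2 := by
  refine le_trans (le_of_eq ?_) (inner_toEuclideanCLM_le_of_posSemidef_sub hlyap x)
  have hmul : BodyMat.op ((outerA + outerB * S.Lbar i).transpose * S.R i) x =
      BodyMat.op (outerA + outerB * S.Lbar i).transpose (BodyMat.op (S.R i) x) := by
    rw [BodyMat.op, map_mul, mul_apply_eq_comp]
  rw [inner_op_symSum, hmul, inner_toEuclideanCLM_transpose,
    ← (isPositive_toEuclideanCLM hR.posSemidef).isSymmetric.apply_clm, real_inner_comm]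

theorem two_mul_inner_op_closedLoop_K_self_le {i : Fin N} (hpν : ∀ i, 0 < -(D.p i * S.ν i))
    (hdiag : ((D.p i * S.ν i * S.ε i) • (1 : BodyMat) - symSum (S.R i * D.Q i i)).PosSemidef)
    (x : BodyState) :
    2 * inner ℝ x (BodyMat.op (S.R i) (BodyMat.op ((S.closedLoop D).K i i) x)) ≤
      -S.ε i * ‖x‖ ^ 2 := by
  have hQ := inner_toEuclideanCLM_le_of_posSemidef_sub hdiag x
  rw [inner_op_symSum, BodyMat.op, map_mul, mul_apply_eq_comp] at hQ
  rw [closedLoop_K hpν, BodyMat.op, BodyMat.op, map_smul, smul_apply, map_smul, inner_smul_right,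
    mul_left_comm, inv_mul_le_iff₀ (hpν i)]
  linarith

theorem isWeaklyCoupled_closedLoop {κ M θ : ℝ} (hR : ∀ i, (S.R i).PosDef)
    (hlyap : ∀ i, (-(S.ρ i) • (1 : BodyMat) -
      symSum ((outerA + outerB * S.Lbar i).transpose * S.R i)).PosSemidef)
    (hpν : ∀ i, 0 < -(D.p i * S.ν i))
    (hdiag : ∀ i, ((D.p i * S.ν i * S.ε i) • (1 : BodyMat) -
      symSum (S.R i * D.Q i i)).PosSemidef)
    (hmin : ∀ i, κ ≤ lambdaMin (S.R i)) (hmax : ∀ i, lambdaMax (S.R i) ≤ M)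
    (hμ : ∀ i, κ ≤ S.μ i)
    (hcoupling : ∀ i, S.couplingSum D i ≤ θ * -(D.p i * S.ν i * S.δ i)) :
    (S.closedLoop D).IsWeaklyCoupled S.R S.μ κ M θ where
  R_posDef := hR
  le_lambdaMin := hmin
  lambdaMax_le := hmax
  le_rate := hμ
  decay i x := by
    rw [map_add, inner_add_right, μ_mul_lambdaMax (hR i)]
    change 2 * (inner ℝ x (BodyMat.op (S.R i)
      (BodyMat.op (outerA + outerB * S.Lbar i) x)) + _) ≤ _
    linarith [two_mul_inner_op_stateMatrix_le (hR i) (hlyap i) x,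
      two_mul_inner_op_closedLoop_K_self_le hpν (hdiag i) x]
  coupling i := by
    have hnorm : ∀ j, specNorm (S.R i * (S.closedLoop D).K i j) =
        (-(D.p i * S.ν i))⁻¹ * specNorm (S.R i * D.Q i j) := fun j => by
      rw [closedLoop_K hpν, mul_smul_comm, specNorm, BodyMat.op, map_smul, norm_smul,
        Real.norm_of_nonneg (inv_pos.2 (hpν i)).le, specNorm]
    rw [Finset.sum_congr rfl fun j _ => hnorm j, ← Finset.mul_sum, inv_mul_le_iff₀ (hpν i)]
    refine (hcoupling i).trans_eq ?_
    rw [δ]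
    ring

end DesignData

theorem isScalableMeshStable_closedLoop {Λ : Type*} {N : Λ → ℕ} {S : ∀ l, DesignData (N l)}
    {D : ∀ l, DesignVars (N l)} (hR : ∀ l i, ((S l).R i).PosDef)
    (hlyap : ∀ l i, (-((S l).ρ i) • (1 : BodyMat) -
      symSum ((outerA + outerB * (S l).Lbar i).transpose * (S l).R i)).PosSemidef)
    (hpν : ∀ l i, 0 < -((D l).p i * (S l).ν i))
    (hdiag : ∀ l i, (((D l).p i * (S l).ν i * (S l).ε i) • (1 : BodyMat) -
      symSum ((S l).R i * (D l).Q i i)).PosSemidef)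
    (hU : UniformData S D) : IsScalableMeshStable N fun l => (S l).closedLoop (D l) := by
  obtain ⟨κ, M, θ, hκ, hθ, hbound⟩ := hU
  refine isScalableMeshStable_of_isWeaklyCoupled hκ (lt_max_of_lt_right one_pos)
    (le_max_right θ 0) (max_lt hθ one_pos) (M := max M 1) fun l =>
    DesignData.isWeaklyCoupled_closedLoop (hR l) (hlyap l) (hpν l) (hdiag l)
      (fun i => (hbound l i).1) (fun i => (hbound l i).2.1.trans (le_max_left M 1))
      (fun i => (hbound l i).2.2.1) fun i => ?_
  refine (hbound l i).2.2.2.trans (mul_le_mul_of_nonneg_right (le_max_left θ 0) ?_)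
  rw [← neg_mul]
  exact mul_nonneg (hpν l i).le (Real.sqrt_nonneg _)

theorem exists_gt_forall_le_of_finite {ι α : Type*} [Finite ι] [LinearOrder α] [NoMaxOrder α]
    {f : ι → α} {c : α} (h : ∀ i, c < f i) : ∃ b, c < b ∧ ∀ i, b ≤ f i := by
  cases isEmpty_or_nonempty ι
  · obtain ⟨b, hb⟩ := exists_gt c
    exact ⟨b, hb, fun i => isEmptyElim i⟩
  · obtain ⟨i, hi⟩ := Finite.exists_min f
    exact ⟨f i, h i, hi⟩

theorem uniformData_unit {N : ℕ} {S : DesignData N} {D : DesignVars N}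
    (hR : ∀ i, (S.R i).PosDef) (hδ : ∀ i, 0 < S.δ i) (hpν : ∀ i, 0 < -(D.p i * S.ν i))
    (hcoupling : ∀ i, S.couplingSum D i < -(D.p i * S.ν i * S.δ i)) :
    UniformData (fun _ : Unit => S) fun _ => D := by
  have hgain : ∀ i, 0 < -(D.p i * S.ν i * S.δ i) := fun i => by
    rw [← neg_mul]
    exact mul_pos (hpν i) (hδ i)
  obtain ⟨κ₁, hκ₁, hmin⟩ := exists_gt_forall_le_of_finite fun i => sInf_spectrum_pos (hR i)
  obtain ⟨κ₂, hκ₂, hμ⟩ := exists_gt_forall_le_of_finite fun i => DesignData.μ_pos (hR i) (hδ i)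
  obtain ⟨M, hM⟩ := (finite_range fun i => lambdaMax (S.R i)).bddAbove
  obtain ⟨θ, hθ, hratio⟩ := exists_gt_forall_le_of_finite (c := -1)
    (f := fun i => -(S.couplingSum D i / -(D.p i * S.ν i * S.δ i)))
    fun i => neg_lt_neg ((div_lt_one (hgain i)).2 (hcoupling i))
  refine ⟨min κ₁ κ₂, M, -θ, lt_min hκ₁ hκ₂, neg_lt.1 hθ, fun _ i =>
    ⟨min_le_of_left_le (hmin i), hM (mem_range_self i), min_le_of_right_le (hμ i), ?_⟩⟩
  exact (div_le_iff₀ (hgain i)).1 (le_neg_of_le_neg (hratio i))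

theorem theorem1_general {Λ : Type*} (N : Λ → ℕ) (S : ∀ l, DesignData (N l))
    (D : ∀ l, DesignVars (N l))
    (hifofp : ∀ l i, IsDissipative (subsystemField ((S l).Lbar i)) (fun x _ => x)
      (supplyIFOFP ((S l).ν i) ((S l).ρ i)))
    (hR : ∀ l i, ((S l).R i).PosDef)
    (hlyap : ∀ l i, (-((S l).ρ i) • (1 : BodyMat) -
      symSum ((outerA + outerB * (S l).Lbar i).transpose * (S l).R i)).PosSemidef)
    (hδ : ∀ l i, 0 < (S l).δ i) (hp : ∀ l i, 0 < (D l).p i) (hγ : ∀ l, 0 ≤ (D l).γ)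
    (hlmi : ∀ l, ((S l).lmiMatrix (D l)).PosDef)
    (hdiag : ∀ l i, (((D l).p i * (S l).ν i * (S l).ε i) • (1 : BodyMat) -
      symSum ((S l).R i * (D l).Q i i)).PosSemidef)
    (hcoupling : ∀ l i, (S l).couplingSum (D l) i < -((D l).p i * (S l).ν i * (S l).δ i)) :
    (∀ l, ((S l).closedLoop (D l)).IsL2Stable (D l).γ ∧
      IsScalableMeshStable (fun _ : Unit => N l) (fun _ => (S l).closedLoop (D l))) ∧
    (UniformData S D →
      IsScalableMeshStable N (fun l => (S l).closedLoop (D l))) := by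
  have hpν : ∀ l i, 0 < -((D l).p i * (S l).ν i) := fun l =>
    DesignData.neg_p_mul_ν_pos_of_lmiMatrix_posDef (hlmi l)
  refine ⟨fun l => ⟨DesignData.isL2Stable_closedLoop (hγ l) (hp l) (hifofp l) (hlmi l), ?_⟩,
    isScalableMeshStable_closedLoop hR hlyap hpν hdiag⟩
  exact isScalableMeshStable_closedLoop (fun _ => hR l) (fun _ => hlyap l)
    (fun _ => hpν l) (fun _ => hdiag l) (uniformData_unit (hR l) (hδ l) (hpν l) (hcoupling l))

theorem theorem1 {Λ : Type*} (N : Λ → ℕ) (S : ∀ l, DesignData (N l)) (D : ∀ l, DesignVars (N l))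
    (hS : ∀ l, (S l).LocalLoops)
    (hD : ∀ l, D l ∈ (S l).centralizedProblem.feasible) :
    (∀ l, (D l).γ ^ 2 < (S l).γbar ∧
      ((S l).closedLoop (D l)).IsL2Stable (D l).γ ∧
      IsScalableMeshStable (fun _ : Unit => N l) (fun _ => (S l).closedLoop (D l))) ∧
    (UniformData S D →
      IsScalableMeshStable N (fun l => (S l).closedLoop (D l))) := by
  obtain ⟨hsingle, hfamily⟩ := theorem1_general N S D (fun l => (hS l).ifofp)
    (fun l => (hS l).R_posDef) (fun l => (hS l).lyapunov) (fun l => (hS l).δ_pos)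
    (fun l => (hD l).p_pos) (fun l => (hD l).γ_pos.le) (fun l => (hD l).lmi)
    (fun l => (hD l).diag_block) fun l => (hD l).weak_coupling
  exact ⟨fun l => ⟨(hD l).γ_lt, hsingle l⟩, hfamily⟩
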